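/- **Theorem (SNOW impossibility with two readers and one writer).** Consider an asynchronous message-passing system with two servers $s_1,s_2$, two readers $r_1,r_2$ and one writer $w$, none of which ever fails. Server $s_i$ stores an object $o_i$ with values in a domain $V_i$ that has at least two elements, and with initial value $v_i^0\in V_i$. A READ transaction, invoked at a reader, reads a nonempty set $I$ of objects and returns a value for each of them; a WRITE transaction, invoked at the writer, writes a value to each object of a nonempty set of objects and returns an acknowledgement. Each process is an arbitrary (possibly nondeterministic) I/O automaton with countably many tasks, whose inputs are invocations (at clients) and receipts of messages, and whose outputs are responses (at clients) and sendings of messages. Between any two distinct processes, in particular between any two clients, there is in each direction a reliable channel, which may reorder messages. Messages are tagged as read requests, as answers carrying exactly one value of one object, or as other messages, and may carry arbitrary further data. The system (the algorithm) is the composition of the processes and channels. Executions are finite or infinite. An execution is *fair* if every task of every component gets infinitely many turns (in particular every message sent is eventually delivered), *fair to a process* if this holds for the tasks of that process, and *well-formed* if each client is invoked only after its previous transaction has completed. Assume that readers do not wait before contacting the servers: in every well-formed execution that is fair to a reader $r$, if a READ of the set $I$ is invoked at $r$ and no further input occurs at $r$, then $r$ eventually sends a read request to $s_i$ for every $i\in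 I$. Then the algorithm cannot have all four of the following SNOW properties, even though clients may send messages to each other. * **S (strict serializability).** In every fair well-formed execution one can choose a set of transactions that contains all complete and possibly some incomplete ones, responses for the chosen incomplete ones, and for each chosen transaction a serialization point after its invocation and before its response (if it is complete), such that the chosen transactions, executed sequentially in the order of these points from the initial values $(v_1^0,v_2^0)$, give exactly these responses. * **N (non-blocking reads).** In every well-formed execution that is fair to a server $s_i$, if $s_i$ receives a read request from a reader $r$ and no further input occurs at $s_i$, then $s_i$ eventually sends to $r$ an answer with a value of $o_i$. * **O (one response).** In every fair well-formed execution, during each complete READ of a set $I$ at a reader $r$, for every $i\in I$ exactly one read request is sent from $r$ to $s_i$ and received there, after which exactly one answer is sent from $s_i$ to $r$ and received; it carries one value of $o_i$, which is the value that the READ returns for $o_i$. Moreover, in every well-formed execution that is fair to $r$, if a READ of $I$ has been invoked at $r$, answers from all $s_i$, $i\in I$, have since arrived, and no further input occurs at $r$, then the READ completes. * **W (concurrent writes, with write liveness).** In every fair well-formed execution, whatever transactions are concurrent, every READ and every WRITE transaction that is invoked eventually completes. -/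

import Mathlib

/-! I/O automata, their composition, executions and fairness; the transaction data type;
the asynchronous message-passing system; strict serializability; the SNOW properties. -/

universe u

namespace Snow

/-! ### I/O automata -/

/-- An I/O automaton over an alphabet `Act` of actions: states, start states, a signature of
pairwise disjoint sets of input, output and internal actions, a transition relation in which every
input action is enabled in every state, and a partition of the locally controlled actions
into tasks. -/
structure IOAutomaton (Act : Type u) where
  State : Type u
  start : Set State
  start_nonempty : start.Nonempty
  inp : Set Act
  out : Set Act
  int : Set Act
  inp_out : Disjoint inp out
  inp_int : Disjoint inp int
  out_int : Disjoint out int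
  step : State → Act → State → Prop
  step_mem : ∀ s a s', step s a s' → a ∈ inp ∪ out ∪ int
  input_enabled : ∀ s, ∀ a ∈ inp, ∃ s', step s a s'
  tasks : Set (Set Act)
  tasks_cover : ⋃₀ tasks = out ∪ int
  tasks_disjoint : tasks.PairwiseDisjoint id

namespace IOAutomaton

variable {Act : Type u}

/-- All actions in the signature. -/
def acts (A : IOAutomaton Act) : Set Act := A.inp ∪ A.out ∪ A.int

/-- Some action of the set `C` is enabled in the state `s`. -/
def Enabled (A : IOAutomaton Act) (s : A.State) (C : Set Act) : Prop :=
  ∃ a ∈ C, ∃ s', A.step s a s'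

/-- Compatibility of a family of automata: internal actions are private, and an action is an output
of at most one of the automata. -/
def Compatible {ι : Type} (A : ι → IOAutomaton Act) : Prop :=
  ∀ i j, i ≠ j → Disjoint (A i).int (A j).acts ∧ Disjoint (A i).out (A j).out

theorem task_subset (A : IOAutomaton Act) {C : Set Act} (hC : C ∈ A.tasks) :
    C ⊆ A.out ∪ A.int := by
  rw [← A.tasks_cover]; exact Set.subset_sUnion_of_mem hC

/-- Composition of a compatible family: every component that has the action in its signature takes
a step with it, all the others keep their states. -/
def compose {ι : Type} (A : ι → IOAutomaton Act) (h : Compatible A) : IOAutomaton Act where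
  State := ∀ i, (A i).State
  start := {s | ∀ i, s i ∈ (A i).start}
  start_nonempty := ⟨fun i => (A i).start_nonempty.some, fun i => (A i).start_nonempty.some_mem⟩
  inp := (⋃ i, (A i).inp) \ ⋃ i, (A i).out
  out := ⋃ i, (A i).out
  int := ⋃ i, (A i).int
  inp_out := Set.disjoint_sdiff_left
  inp_int := by
    rw [Set.disjoint_left]
    rintro a ⟨ha, -⟩ hb
    obtain ⟨i, hi⟩ := Set.mem_iUnion.1 ha
    obtain ⟨j, hj⟩ := Set.mem_iUnion.1 hb
    by_cases hij : j = i
    · subst hij; exact Set.disjoint_left.1 (A j).inp_int hi hj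
    · exact Set.disjoint_left.1 (h j i hij).1 hj (Or.inl (Or.inl hi))
  out_int := by
    rw [Set.disjoint_left]
    rintro a ha hb
    obtain ⟨i, hi⟩ := Set.mem_iUnion.1 ha
    obtain ⟨j, hj⟩ := Set.mem_iUnion.1 hb
    by_cases hij : j = i
    · subst hij; exact Set.disjoint_left.1 (A j).out_int hi hj
    · exact Set.disjoint_left.1 (h j i hij).1 hj (Or.inl (Or.inr hi))
  step := fun s a s' => (∃ i, a ∈ (A i).acts) ∧
    ∀ i, (a ∈ (A i).acts → (A i).step (s i) a (s' i)) ∧ (a ∉ (A i).acts → s' i = s i)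
  step_mem := by
    rintro s a s' ⟨⟨i, hi⟩, -⟩
    by_cases ho : a ∈ ⋃ i, (A i).out
    · exact Or.inl (Or.inr ho)
    · rcases hi with (hi | hi) | hi
      · exact Or.inl (Or.inl ⟨Set.mem_iUnion.2 ⟨i, hi⟩, ho⟩)
      · exact Or.inl (Or.inr (Set.mem_iUnion.2 ⟨i, hi⟩))
      · exact Or.inr (Set.mem_iUnion.2 ⟨i, hi⟩)
  input_enabled := by
    rintro s a ⟨ha, hno⟩
    obtain ⟨i₀, hi₀⟩ := Set.mem_iUnion.1 ha
    have key : ∀ i, ∃ t, (a ∈ (A i).acts → (A i).step (s i) a t) ∧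
        (a ∉ (A i).acts → t = s i) := by
      intro i
      by_cases hi : a ∈ (A i).acts
      · rcases hi with (hi | hi) | hi
        · obtain ⟨t, ht⟩ := (A i).input_enabled (s i) a hi
          exact ⟨t, fun _ => ht, fun hn => absurd (Or.inl (Or.inl hi)) hn⟩
        · exact absurd (Set.mem_iUnion.2 ⟨i, hi⟩) hno
        · by_cases hii : i = i₀
          · subst hii; exact absurd hi (Set.disjoint_left.1 (A i).inp_int hi₀)
          · exact absurd (Or.inl (Or.inl hi₀)) (Set.disjoint_left.1 (h i i₀ hii).1 hi)
      · exact ⟨s i, fun hh => absurd hh hi, fun _ => rfl⟩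
    choose t ht using key
    exact ⟨t, ⟨i₀, Or.inl (Or.inl hi₀)⟩, ht⟩
  tasks := ⋃ i, (A i).tasks
  tasks_cover := by
    rw [Set.sUnion_iUnion, ← Set.iUnion_union_distrib]
    exact Set.iUnion_congr fun i => (A i).tasks_cover
  tasks_disjoint := by
    intro C hC C' hC' hne
    obtain ⟨i, hi⟩ := Set.mem_iUnion.1 hC
    obtain ⟨j, hj⟩ := Set.mem_iUnion.1 hC'
    by_cases hij : i = j
    · subst hij; exact (A i).tasks_disjoint hi hj hne
    · refine Set.disjoint_left.2 fun a ha ha' => ?_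
      rcases (A i).task_subset hi ha with h1 | h1 <;> rcases (A j).task_subset hj ha' with h2 | h2
      · exact Set.disjoint_left.1 (h i j hij).2 h1 h2
      · exact Set.disjoint_left.1 (h j i (Ne.symm hij)).1 h2 (Or.inl (Or.inr h1))
      · exact Set.disjoint_left.1 (h i j hij).1 h1 (Or.inl (Or.inr h2))
      · exact Set.disjoint_left.1 (h i j hij).1 h1 (Or.inr h2)

/-- An execution, finite (`len = n`) or infinite (`len = ⊤`): the alternating sequence
`state 0, act 0, state 1, act 1, …` that starts in a start state. The entries `act n` with
`n ≥ len` and `state n` with `n > len` are irrelevant padding. -/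
structure Exec (A : IOAutomaton Act) where
  len : ℕ∞
  state : ℕ → A.State
  act : ℕ → Act
  init : state 0 ∈ A.start
  steps : ∀ n : ℕ, (n : ℕ∞) < len → A.step (state n) (act n) (state (n + 1))

/-- The `n`-th event of the execution is the action `a`. -/
def Exec.Occurs {A : IOAutomaton Act} (e : A.Exec) (n : ℕ) (a : Act) : Prop :=
  (n : ℕ∞) < e.len ∧ e.act n = a

/-- Fairness of an execution to a task `C`: if the execution is finite then `C` is not enabled in its
last state; if it is infinite then it has infinitely many events from `C` or infinitely many states
in which `C` is not enabled. -/
def Exec.FairTo {A : IOAutomaton Act} (e : A.Exec) (C : Set Act) : Prop :=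
  (∀ n : ℕ, e.len = n → ¬ A.Enabled (e.state n) C) ∧
  (e.len = ⊤ → (∃ᶠ n in Filter.atTop, e.act n ∈ C) ∨
    (∃ᶠ n in Filter.atTop, ¬ A.Enabled (e.state n) C))

/-- A fair execution. -/
def Exec.Fair {A : IOAutomaton Act} (e : A.Exec) : Prop := ∀ C ∈ A.tasks, e.FairTo C

end IOAutomaton

/-! ### The data type -/

section DataType

variable {k : ℕ}

/-- Invocations: `READ(o_i : i ∈ I)` for a nonempty set `I` of objects, and
`WRITE((o_i, x i) : x i ≠ none)` for a partial assignment `x` that writes at least one object. -/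
inductive Invocation (V : Fin k → Type u) : Type u
  | read (I : Finset (Fin k)) (hI : I.Nonempty)
  | write (x : ∀ i, Option (V i)) (hx : ∃ i, x i ≠ none)

/-- Responses: a tuple of values for some of the objects, or an acknowledgement. -/
inductive Response (V : Fin k → Type u) : Type u
  | values (y : ∀ i, Option (V i))
  | ack

/-- The sequential specification of the data type: the response to an invocation and the new
tuple of values of the objects. -/
def apply {V : Fin k → Type u} :
    Invocation V → (∀ i, V i) → Response V × (∀ i, V i)
  | .read I _, s => (.values fun i => if i ∈ I then some (s i) else none, s)
  | .write x _, s => (.ack, fun i => (x i).getD (s i))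

end DataType

/-! ### The system -/

/-- Processes: `k` servers (server `i` stores object `i`), `m` readers and `l` writers. -/
inductive Proc (k m l : ℕ) : Type
  | server (i : Fin k)
  | reader (r : Fin m)
  | writer (w : Fin l)

/-- Messages. Each message is tagged as a read request, as an answer that carries exactly one
value of object `i`, or as any other message, and has an arbitrary further content in `D`. -/
inductive Msg {k : ℕ} (V : Fin k → Type u) (D : Type u) : Type u
  | readReq (d : D)
  | value (i : Fin k) (v : V i) (d : D)
  | other (d : D)

/-- Actions of the system: invocation and response of a transaction at a client, sending and
receiving of a message `msg` from `p` to `q`, internal actions of a process. -/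
inductive Act {k : ℕ} (m l : ℕ) (V : Fin k → Type u) (D H : Type u) : Type u
  | inv (p : Proc k m l) (t : Invocation V)
  | resp (p : Proc k m l) (ρ : Response V)
  | send (p q : Proc k m l) (msg : Msg V D)
  | recv (p q : Proc k m l) (msg : Msg V D)
  | internal (p : Proc k m l) (x : H)

section System

variable {k m l : ℕ} {V : Fin k → Type u} {D H : Type u}

/-- Readers are invoked with READ transactions only, writers with WRITE transactions only, and
servers with no transactions. -/
def MayInvoke : Proc k m l → Invocation V → Prop
  | .reader _, .read _ _ => True
  | .writer _, .write _ _ => True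
  | _, _ => False

/-- Readers respond with values, writers with an acknowledgement. -/
def MayRespond : Proc k m l → Response V → Prop
  | .reader _, .values _ => True
  | .writer _, .ack => True
  | _, _ => False

/-- Input actions of process `p`: invocations by its user, and receipts of messages from any other
process. -/
def procInp (p : Proc k m l) : Set (Act m l V D H) :=
  {a | (∃ t, MayInvoke p t ∧ a = .inv p t) ∨ ∃ q msg, q ≠ p ∧ a = .recv q p msg}

/-- Output actions of process `p`: responses to its user, and sending of messages to any other
process. -/
def procOut (p : Proc k m l) : Set (Act m l V D H) :=
  {a | (∃ ρ, MayRespond p ρ ∧ a = .resp p ρ) ∨ ∃ q msg, q ≠ p ∧ a = .send p q msg}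

/-- Internal actions of process `p`. -/
def procInt (p : Proc k m l) : Set (Act m l V D H) := {a | ∃ x, a = .internal p x}

variable (m l V D H) in
/-- An algorithm: one I/O automaton for each process, with the prescribed signature and countably
many tasks. -/
structure Algorithm where
  proc : Proc k m l → IOAutomaton (Act m l V D H)
  inp_eq : ∀ p, (proc p).inp = procInp p
  out_eq : ∀ p, (proc p).out = procOut p
  int_eq : ∀ p, (proc p).int = procInt p
  tasks_countable : ∀ p, (proc p).tasks.Countable

variable (V D H) in
/-- The asynchronous reliable channel from `p` to `q`. Its state is the multiset of messages in
transit; they may be delivered in any order, and (one task for each message)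
a message in transit is eventually delivered in every fair execution. -/
def channel (p q : Proc k m l) : IOAutomaton (Act m l V D H) where
  State := Multiset (Msg V D)
  start := {0}
  start_nonempty := ⟨0, rfl⟩
  inp := {a | ∃ msg, a = .send p q msg}
  out := {a | ∃ msg, a = .recv p q msg}
  int := ∅
  inp_out := by
    rw [Set.disjoint_left]; rintro a ⟨_, rfl⟩ ⟨_, h⟩; cases h
  inp_int := Set.disjoint_empty _
  out_int := Set.disjoint_empty _
  step := fun s a s' => ∃ msg, (a = .send p q msg ∧ s' = msg ::ₘ s) ∨
    (a = .recv p q msg ∧ s = msg ::ₘ s')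
  step_mem := by
    rintro s a s' ⟨msg, ⟨h, -⟩ | ⟨h, -⟩⟩
    · exact Or.inl (Or.inl ⟨msg, h⟩)
    · exact Or.inl (Or.inr ⟨msg, h⟩)
  input_enabled := by
    rintro s a ⟨msg, rfl⟩; exact ⟨_, msg, Or.inl ⟨rfl, rfl⟩⟩
  tasks := Set.range fun msg => {Act.recv p q msg}
  tasks_cover := by
    ext a; simp [eq_comm]
  tasks_disjoint := by
    rintro _ ⟨x, rfl⟩ _ ⟨y, rfl⟩ h
    simp only [Function.onFun, id, Set.disjoint_singleton]
    intro hxy; exact h (by simp [hxy])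

variable (k m l) in
/-- Components of the system: the processes, and one channel for every ordered pair of distinct
processes (so also between any two clients). -/
abbrev Component : Type := Proc k m l ⊕ {pq : Proc k m l × Proc k m l // pq.1 ≠ pq.2}

/-- The automaton of each component. -/
def Algorithm.component (A : Algorithm m l V D H) : Component k m l → IOAutomaton (Act m l V D H)
  | .inl p => A.proc p
  | .inr pq => channel V D H pq.1.1 pq.1.2

theorem Algorithm.compatible (A : Algorithm m l V D H) :
    IOAutomaton.Compatible A.component := by
  rintro (p | ⟨⟨p, p'⟩, hp⟩) (q | ⟨⟨q, q'⟩, hq⟩) hne <;>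
    simp only [Algorithm.component, IOAutomaton.acts, A.inp_eq, A.out_eq, A.int_eq, channel,
      Set.disjoint_left] <;>
    refine ⟨?_, ?_⟩
  all_goals
    intro a ha hb
    simp only [procInp, procOut, procInt, Set.mem_union, Set.mem_ofPred_eq,
      Set.mem_empty_iff_false] at ha hb
    try grind

/-- The whole system: the composition of all processes and channels. -/
def Algorithm.system (A : Algorithm m l V D H) : IOAutomaton (Act m l V D H) :=
  IOAutomaton.compose A.component A.compatible

/-- Executions of the system. -/
abbrev Algorithm.Exec (A : Algorithm m l V D H) := A.system.Exec

variable {A : Algorithm m l V D H}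

/-- The execution is fair to process `p`: to all tasks of the automaton of `p` (the other components
may be delayed arbitrarily). -/
def FairFor (e : A.Exec) (p : Proc k m l) : Prop := ∀ C ∈ (A.proc p).tasks, e.FairTo C

/-- No input action of `p` occurs after position `n`. -/
def NoInputAfter (e : A.Exec) (p : Proc k m l) (n : ℕ) : Prop :=
  ∀ j a, n < j → e.Occurs j a → a ∉ procInp p

/-! ### Transactions -/

/-- A transaction of an execution is identified with the position `n` of its invocation at the
client `p`; its response is the first response action at `p` after `n`. Here it is
the action at position `j`, with response `ρ`. -/
def Answered (e : A.Exec) (p : Proc k m l) (n j : ℕ) (ρ : Response V) : Prop :=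
  n < j ∧ e.Occurs j (.resp p ρ) ∧ ∀ i ρ', n < i → i < j → ¬ e.Occurs i (.resp p ρ')

/-- Well-formed executions: a client is invoked only after its previous transactions have
completed. -/
def WellFormed (e : A.Exec) : Prop :=
  ∀ p t t' n n', n < n' → e.Occurs n (.inv p t) → e.Occurs n' (.inv p t') →
    ∃ j ρ, n < j ∧ j < n' ∧ e.Occurs j (.resp p ρ)

/-- A serialization of an execution. A finite or infinite list of `len` transactions (`pos j` is the
position of the invocation of the `j`-th) contains all the complete transactions and possibly some
incomplete ones. The `j`-th has its serialization point `point j` after its invocation, and before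
its response if it is complete (position `n` of the execution is at time `n`). If it is complete then
`resp j` is its actual response, otherwise `resp j` is a response that is selected for it. Executed in the
order of the serialization points, the transactions form a sequential execution of the
data type, with the values `value 0, value 1, …` of the objects. -/
structure Serialization (v₀ : ∀ i, V i) (e : A.Exec) where
  len : ℕ∞
  pos : ℕ → ℕ
  point : ℕ → ℝ
  resp : ℕ → Response V
  value : ℕ → ∀ i, V i
  isInv : ∀ j : ℕ, (j : ℕ∞) < len → ∃ p t, e.Occurs (pos j) (.inv p t)
  distinct : ∀ i j : ℕ, (i : ℕ∞) < len → (j : ℕ∞) < len → pos i = pos j → i = j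
  complete : ∀ n p t i ρ, e.Occurs n (.inv p t) → Answered e p n i ρ →
    ∃ j : ℕ, (j : ℕ∞) < len ∧ pos j = n
  ordered : ∀ i j : ℕ, i < j → (j : ℕ∞) < len → point i < point j
  after_inv : ∀ j : ℕ, (j : ℕ∞) < len → (pos j : ℝ) < point j
  before_resp : ∀ j : ℕ, (j : ℕ∞) < len → ∀ p t i ρ, e.Occurs (pos j) (.inv p t) →
    Answered e p (pos j) i ρ → point j < i ∧ resp j = ρ
  value_zero : value 0 = v₀
  legal : ∀ j : ℕ, (j : ℕ∞) < len → ∀ p t, e.Occurs (pos j) (.inv p t) →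
    apply t (value j) = (resp j, value (j + 1))

/-! ### The SNOW properties -/

/-- S: every fair well-formed execution is strictly serializable. -/
def StrictlySerializable (v₀ : ∀ i, V i) (A : Algorithm m l V D H) : Prop :=
  ∀ e : A.Exec, e.Fair → WellFormed e → Nonempty (Serialization v₀ e)

/-- N: if server `i` receives a read request from reader `r` and no other input action follows at
the server, then the server eventually sends a value of object `i` to `r`, provided only that the
server itself is not delayed forever. -/
def NonBlocking (A : Algorithm m l V D H) : Prop :=
  ∀ e : A.Exec, WellFormed e → ∀ i r, FairFor e (.server i) →
    ∀ n d, e.Occurs n (.recv (.reader r) (.server i) (.readReq d)) →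
      NoInputAfter e (.server i) n →
      ∃ j v d', n < j ∧ e.Occurs j (.send (.server i) (.reader r) (.value i v d'))

/-- Between the positions `n` and `j`, reader `r` and server `i` exchange exactly one read request
and, afterwards, exactly one answer, which carries the value `v` of object `i`. -/
def OneRoundTrip (e : A.Exec) (r : Fin m) (i : Fin k) (v : V i) (n j : ℕ) : Prop :=
  ∃ (a b c c' : ℕ) (d d' : D), n < a ∧ a < b ∧ b < c ∧ c < c' ∧ c' < j ∧
    e.Occurs a (.send (.reader r) (.server i) (.readReq d)) ∧
    e.Occurs b (.recv (.reader r) (.server i) (.readReq d)) ∧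
    e.Occurs c (.send (.server i) (.reader r) (.value i v d')) ∧
    e.Occurs c' (.recv (.server i) (.reader r) (.value i v d')) ∧
    (∀ x, n < x → x < j → ∀ y,
      (e.Occurs x (.send (.reader r) (.server i) (.readReq y)) → x = a) ∧
      (e.Occurs x (.recv (.reader r) (.server i) (.readReq y)) → x = b)) ∧
    (∀ x, n < x → x < j → ∀ i' w y,
      (e.Occurs x (.send (.server i) (.reader r) (.value i' w y)) → x = c) ∧
      (e.Occurs x (.recv (.server i) (.reader r) (.value i' w y)) → x = c'))

/-- O: every completed READ transaction consists of one round trip with each of the servers that it reads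
from, and returns for each object the one value in the answer of the server; and the
READ completes once the answers have arrived, without waiting for any further input at the reader. -/
def OneResponse (A : Algorithm m l V D H) : Prop :=
  (∀ e : A.Exec, e.Fair → WellFormed e → ∀ r I hI n j y,
    e.Occurs n (.inv (.reader r) (.read I hI)) → Answered e (.reader r) n j (.values y) →
      ∀ i ∈ I, ∃ v, y i = some v ∧ OneRoundTrip e r i v n j) ∧
  (∀ e : A.Exec, WellFormed e → ∀ r, FairFor e (.reader r) → ∀ I hI n j,
    e.Occurs n (.inv (.reader r) (.read I hI)) →
    (∀ i ∈ I, ∃ c v d, n < c ∧ c ≤ j ∧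
      e.Occurs c (.recv (.server i) (.reader r) (.value i v d))) →
    NoInputAfter e (.reader r) j →
    ∃ j' ρ, n < j' ∧ e.Occurs j' (.resp (.reader r) ρ))

/-- W, with the liveness of writes as a part: in every fair well-formed execution, whatever
transactions are concurrent, every READ and every WRITE transaction completes. -/
def ConcurrentWrites (A : Algorithm m l V D H) : Prop :=
  ∀ e : A.Exec, e.Fair → WellFormed e → ∀ p t n, e.Occurs n (.inv p t) →
    ∃ j ρ, Answered e p n j ρ

/-- The SNOW properties, for the initial values `v₀` of the objects. -/
structure SNOW (v₀ : ∀ i, V i) (A : Algorithm m l V D H) : Prop where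
  S : StrictlySerializable v₀ A
  N : NonBlocking A
  O : OneResponse A
  W : ConcurrentWrites A

/-- When a READ is invoked, the reader contacts the servers without waiting for any incoming
message. -/
def ReadersDoNotWait (A : Algorithm m l V D H) : Prop :=
  ∀ e : A.Exec, WellFormed e → ∀ r, FairFor e (.reader r) → ∀ I hI n,
    e.Occurs n (.inv (.reader r) (.read I hI)) → NoInputAfter e (.reader r) n →
    ∀ i ∈ I, ∃ j d, n < j ∧ e.Occurs j (.send (.reader r) (.server i) (.readReq d))

end System

end Snow

/-!
The proof looks at one WRITE of values `x` that differ from the initial values `v₀` in both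
objects, and lets the two readers read both objects. By strict serializability a READ returns `v₀`
or `x`, never a mixture, and by the one-response property its result consists of the values in the
only answers that the servers send to it. A reader sends its requests right after its invocation
without any further input, and a server answers a request without any further input. The possible
results of a READ performed in isolation in a system state `s` are therefore determined by the
local states of the reader and of the two servers in `s` (`ReadStart`, `ServerAnswer`), and these
pieces can be transplanted into every other execution in which those processes are in the same
states. Say that a reader sees only the initial values in `s` if all these results are `v₀`
(`SeesInitial`).

Take a fair execution in which only the WRITE is invoked. In its start state both readers see only
the initial values, and this is invariant under every step of it. The step takes place at one
process, so it is not at one of the readers, `r'`, and not at one of the servers. Server and reader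
notice nothing, so that server still answers `r'` with the initial value, and by strict
serializability so does the other one (`History.seesInitial_of_step`). If after the step the other
reader `r` could see `x`, then let it complete its READ, and let `r'` read afterwards. The second
READ has to return `x` (`History.answers_eq_of_resp`). But server `0` cannot tell this execution
from the one in which server `1` has not yet received the request of `r`, where server `1` answers
`r'` as it would without the READ of `r`, that is, with the initial value, so that server `0` does
the same (`History.seesInitial_of_seesInitial`). Hence both readers see only the initial values
even after the response of the WRITE, which contradicts strict serializability.

All executions have to be completed to fair ones. The processes have countably many tasks, but a
channel has one task for each message, so a round robin over all tasks is not possible. The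
scheduler `exists_fair_schedule` only needs that countably many tasks are enabled in each state,
and takes its turns among the tasks that were enabled in some earlier state.
-/

namespace Snow

/-! ### Fair scheduling -/

/-- Let `En s` be the set of tasks that are enabled in the state `s`, nonempty and countable. Then
there is an infinite sequence `x` of states and of tasks `c` performed in them that is fair to
every task. -/
theorem exists_fair_schedule {S : Type*} {T : Type*} (En : S → Set T)
    (hc : ∀ s, (En s).Countable) (hne : ∀ s, (En s).Nonempty)
    (R : S → T → S → Prop) (hR : ∀ s, ∀ C ∈ En s, ∃ s', R s C s') (s₀ : S) :
    ∃ (x : ℕ → S) (c : ℕ → T), x 0 = s₀ ∧ (∀ n, R (x n) (c n) (x (n + 1))) ∧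
      ∀ C, (∃ᶠ n in Filter.atTop, c n = C) ∨ ∃ᶠ n in Filter.atTop, C ∉ En (x n) := by
  choose en hen using fun s => (hc s).exists_eq_range (hne s)
  -- `g i j` is the `j`-th task that is enabled in the `i`-th state; `task g t` is the task whose
  -- turn is `t`
  let task : (ℕ → ℕ → T) → ℕ → T := fun g t => g t.unpair.1.unpair.1 t.unpair.1.unpair.2
  -- every pair `(i, j)` is the target of arbitrarily late turns
  have late : ∀ i j N, ∃ t ≥ N, ∀ g, task g t = g i j := fun i j N =>
    ⟨Nat.pair (Nat.pair i j) N, Nat.right_le_pair _ _, fun g => by simp [task]⟩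
  -- the number `n` of steps so far, the current state, the next turn, and the tasks of the states
  -- up to the `n`-th; a step skips to the next turn whose task is enabled
  let D := {d : ℕ × S × ℕ × (ℕ → ℕ → T) // d.2.2.2 d.1 = en d.2.1}
  have step : ∀ d : D, ∃ (C : T) (d' : D), R d.1.2.1 C d'.1.2.1 ∧ d'.1.1 = d.1.1 + 1 ∧
      d.1.2.2.1 < d'.1.2.2.1 ∧ (∀ i ≤ d.1.1, d'.1.2.2.2 i = d.1.2.2.2 i) ∧
      ∀ t, d.1.2.2.1 ≤ t → t < d'.1.2.2.1 → task d.1.2.2.2 t ∈ En d.1.2.1 →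
        C = task d.1.2.2.2 t := by
    rintro ⟨⟨n, s, t, g⟩, hg⟩
    have hex : ∃ t', t ≤ t' ∧ task g t' ∈ En s := by
      obtain ⟨t', ht', h⟩ := late n 0 t
      refine ⟨t', ht', ?_⟩
      rw [h, hen s]
      exact ⟨0, by rw [← hg]⟩
    classical
    obtain ⟨ht, hmem⟩ := Nat.find_spec hex
    obtain ⟨s', hs'⟩ := hR s _ hmem
    refine ⟨task g (Nat.find hex), ⟨⟨n + 1, s', Nat.find hex + 1,
      Function.update g (n + 1) (en s')⟩, by simp⟩, hs', rfl, Nat.lt_succ_of_le ht, ?_, ?_⟩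
    · intro i hi
      exact Function.update_of_ne (by simp at hi; omega) _ _
    · intro t'' h1 h2 h3
      have : Nat.find hex ≤ t'' := Nat.find_min' hex ⟨h1, h3⟩
      have : Nat.find hex = t'' := le_antisymm this (Nat.lt_succ_iff.1 h2)
      rw [this]
  choose C nx h1 h2 h3 h4 h5 using step
  let d : ℕ → D := fun n => Nat.rec ⟨⟨0, s₀, 0, fun _ => en s₀⟩, rfl⟩ (fun _ => nx) n
  have hd : ∀ n, d (n + 1) = nx (d n) := fun n => rfl
  have hn : ∀ n, (d n).1.1 = n := by
    intro n
    induction n with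
    | zero => rfl
    | succ n ih => rw [hd, h2, ih]
  have hg : ∀ i n, i ≤ n → (d n).1.2.2.2 i = en (d i).1.2.1 := by
    intro i n hin
    induction n, hin using Nat.le_induction with
    | base => have := (d i).2; rwa [hn] at this
    | succ n hin ih => rw [hd, h4 _ _ (by rwa [hn]), ih]
  have hmono : StrictMono fun n => (d n).1.2.2.1 := strictMono_nat_of_lt_succ fun n => h3 (d n)
  refine ⟨fun n => (d n).1.2.1, fun n => C (d n), rfl, fun n => h1 (d n), fun K => ?_⟩
  by_contra hcon
  rw [not_or, Filter.not_frequently, Filter.not_frequently] at hcon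
  obtain ⟨N, hN⟩ := Filter.eventually_atTop.1 (hcon.1.and hcon.2)
  -- from `N` on, `K` is enabled but never scheduled; it is the `j`-th task enabled in state `N`
  have hK : K ∈ Set.range (en (d N).1.2.1) := by
    rw [← hen]; exact not_not.1 (hN N le_rfl).2
  obtain ⟨j, hj⟩ := hK
  obtain ⟨t, ht, htask⟩ := late N j (d N).1.2.2.1
  -- the step `M` that passes the turn `t`
  obtain ⟨M, hM1, hM2⟩ : ∃ M, (d M).1.2.2.1 ≤ t ∧ t < (d (M + 1)).1.2.2.1 := by
    have hex : ∃ M, t < (d (M + 1)).1.2.2.1 := ⟨t, by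
      have := hmono.le_apply (x := t + 1)
      omega⟩
    classical
    refine ⟨Nat.find hex, ?_, Nat.find_spec hex⟩
    rcases Nat.eq_zero_or_pos (Nat.find hex) with h0 | h0
    · rw [h0]; exact (Nat.zero_le _)
    · have := Nat.find_min hex (m := Nat.find hex - 1) (by omega)
      rw [Nat.sub_add_cancel h0] at this
      exact not_lt.1 this
  have hNM : N ≤ M := by
    by_contra hlt
    have h6 := hmono.monotone (show M + 1 ≤ N by omega)
    exact absurd (hM2.trans_le h6) (not_lt.2 ht)
  have htK : task (d M).1.2.2.2 t = K := by rw [htask, hg N M hNM, hj]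
  have := h5 (d M) t hM1 (by rw [← hd]; exact hM2) (by rw [htK]; exact not_not.1 (hN M hNM).2)
  exact (hN M hNM).1 (this.trans htK)

/-! ### Finite runs and their fair continuations -/

theorem frequently_succ {p : ℕ → Prop} (h : ∃ᶠ n in Filter.atTop, p (n + 1)) :
    ∃ᶠ n in Filter.atTop, p n :=
  (Filter.tendsto_add_atTop_nat 1).frequently h

namespace IOAutomaton

variable {Act : Type u}

/-- `B.Run s l s'`: performing the list `l` of actions can lead from the state `s` to `s'`. -/
inductive Run (B : IOAutomaton Act) : B.State → List Act → B.State → Prop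
  | nil (s) : Run B s [] s
  | cons {s a s₁ l s₂} (h : B.step s a s₁) (hl : Run B s₁ l s₂) : Run B s (a :: l) s₂

theorem Run.append {B : IOAutomaton Act} {s l s₁ l' s₂} (h : B.Run s l s₁) (h' : B.Run s₁ l' s₂) :
    B.Run s (l ++ l') s₂ := by
  induction h with
  | nil => exact h'
  | cons hs _ ih => exact .cons hs (ih h')

theorem Run.singleton {B : IOAutomaton Act} {s a s'} (h : B.step s a s') : B.Run s [a] s' :=
  .cons h (.nil _)

theorem Exec.run {B : IOAutomaton Act} (e : B.Exec) (n k : ℕ) (h : ((n + k : ℕ) : ℕ∞) ≤ e.len) :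
    B.Run (e.state n) ((List.range' n k).map e.act) (e.state (n + k)) := by
  induction k generalizing n with
  | zero => exact .nil _
  | succ k ih =>
    rw [List.range'_succ, List.map_cons]
    refine .cons (e.steps n (lt_of_lt_of_le ?_ h)) ?_
    · exact_mod_cast (by omega : n < n + (k + 1))
    · have := ih (n + 1) (by rwa [show n + 1 + k = n + (k + 1) by omega])
      rwa [show n + 1 + k = n + (k + 1) by omega] at this

/-- The alternating sequence `state`, `act` of length `len` starts in `s` with the
actions `l`, after which only actions from the tasks in `𝒞` occur, and is fair to these tasks. -/
structure IsFairFragment (B : IOAutomaton Act) (𝒞 : Set (Set Act)) (s : B.State) (l : List Act)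
    (s' : B.State) (len : ℕ∞) (state : ℕ → B.State) (act : ℕ → Act) : Prop where
  zero : state 0 = s
  steps : ∀ n : ℕ, (n : ℕ∞) < len → B.step (state n) (act n) (state (n + 1))
  pre : ∀ (n : ℕ) a, l[n]? = some a → (n : ℕ∞) < len ∧ act n = a
  length_le : (l.length : ℕ∞) ≤ len
  state_length : state l.length = s'
  post : ∀ n : ℕ, l.length ≤ n → (n : ℕ∞) < len → act n ∈ ⋃₀ 𝒞
  fair_fin : ∀ C ∈ 𝒞, ∀ n : ℕ, len = n → ¬ B.Enabled (state n) C
  fair_inf : ∀ C ∈ 𝒞, len = ⊤ → (∃ᶠ n in Filter.atTop, act n ∈ C) ∨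
    ∃ᶠ n in Filter.atTop, ¬ B.Enabled (state n) C

theorem IsFairFragment.cons {B : IOAutomaton Act} {𝒞 : Set (Set Act)} {s₀ a s l s' len state act}
    (h₀ : B.step s₀ a s) (h : B.IsFairFragment 𝒞 s l s' len state act) :
    B.IsFairFragment 𝒞 s₀ (a :: l) s' (len + 1)
      (fun n => Nat.casesOn n s₀ state) (fun n => Nat.casesOn n a act) where
  zero := rfl
  steps := by
    rintro (_ | n) hn
    · show B.step s₀ a (state 0)
      rw [h.zero]; exact h₀
    · refine h.steps n ?_
      push_cast at hn
      exact (ENat.add_lt_add_iff_right ENat.one_ne_top).1 hn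
  pre := by
    rintro (_ | n) b hb
    · simp only [List.getElem?_cons_zero, Option.some.injEq] at hb
      exact ⟨by simp, hb⟩
    · obtain ⟨h1, h2⟩ := h.pre n b (by simpa using hb)
      refine ⟨?_, h2⟩
      push_cast
      exact (ENat.add_lt_add_iff_right ENat.one_ne_top).2 h1
  length_le := by
    simp only [List.length_cons]; push_cast
    gcongr; exact h.length_le
  state_length := h.state_length
  post := by
    rintro (_ | n) h1 h2
    · simp at h1
    · refine h.post n (by simpa using h1) ?_
      push_cast at h2
      exact (ENat.add_lt_add_iff_right ENat.one_ne_top).1 h2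
  fair_fin := by
    rintro C hC (_ | n) hn
    · simp at hn
    · refine h.fair_fin C hC n ?_
      push_cast at hn
      exact ENat.add_left_injective_of_ne_top ENat.one_ne_top hn
  fair_inf := by
    intro C hC hn
    have : len = ⊤ := by
      by_contra hne
      exact (WithTop.add_ne_top.2 ⟨hne, ENat.one_ne_top⟩) hn
    rcases h.fair_inf C hC this with h1 | h1
    · exact Or.inl (frequently_succ h1)
    · exact Or.inr (frequently_succ h1)

theorem IsFairFragment.append {B : IOAutomaton Act} {𝒞 : Set (Set Act)} {s₀ l₀ s l s' len state act}
    (h₀ : B.Run s₀ l₀ s) (h : B.IsFairFragment 𝒞 s l s' len state act) :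
    ∃ len state act, B.IsFairFragment 𝒞 s₀ (l₀ ++ l) s' len state act := by
  induction h₀ with
  | nil => exact ⟨_, _, _, h⟩
  | cons hs _ ih =>
    obtain ⟨_, _, _, h'⟩ := ih h
    exact ⟨_, _, _, h'.cons hs⟩

/-- From every state there is a fair continuation. If some state without enabled tasks can be
reached, stop there; otherwise a schedule runs forever. -/
theorem exists_isFairFragment [Nonempty Act] (B : IOAutomaton Act) (𝒞 : Set (Set Act))
    (hc : ∀ s, {C ∈ 𝒞 | B.Enabled s C}.Countable) (s : B.State) :
    ∃ len state act, B.IsFairFragment 𝒞 s [] s len state act := by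
  by_cases hhalt : ∃ l s', B.Run s l s' ∧ (∀ a ∈ l, a ∈ ⋃₀ 𝒞) ∧ ∀ C ∈ 𝒞, ¬ B.Enabled s' C
  · obtain ⟨l, s', hl, hloc, hdead⟩ := hhalt
    have h0 : B.IsFairFragment 𝒞 s' [] s' 0 (fun _ => s') (fun _ => Classical.arbitrary Act) :=
      { zero := rfl
        steps := by simp
        pre := by simp
        length_le := by simp
        state_length := rfl
        post := by simp
        fair_fin := fun C hC _ _ => hdead C hC
        fair_inf := by simp }
    obtain ⟨len, state, act, h⟩ := h0.append hl
    rw [List.append_nil] at h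
    refine ⟨len, state, act,
      { h with pre := by simp, length_le := by simp, state_length := h.zero, post := ?_ }⟩
    intro n _ hn
    by_cases hnl : n < l.length
    · have := (h.pre n l[n] (by simp [hnl])).2
      rw [this]; exact hloc _ (List.getElem_mem _)
    · exact h.post n (not_lt.1 hnl) hn
  · push Not at hhalt
    let S := {x : B.State // ∃ l, B.Run s l x ∧ ∀ a ∈ l, a ∈ ⋃₀ 𝒞}
    let Q : S → Set Act → S → Prop := fun x C x' => C ∈ 𝒞 ∧ ∃ a ∈ C, B.step x.1 a x'.1
    have hQ : ∀ x : S, ∀ C ∈ {C ∈ 𝒞 | B.Enabled x.1 C}, ∃ x', Q x C x' := by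
      rintro ⟨x, l, hl, hloc⟩ C ⟨hC, a, ha, x', hx'⟩
      refine ⟨⟨x', l ++ [a], hl.append (.singleton hx'), ?_⟩, hC, a, ha, hx'⟩
      intro b hb
      rcases List.mem_append.1 hb with hb | hb
      · exact hloc b hb
      · rw [List.mem_singleton.1 hb]; exact ⟨C, hC, ha⟩
    obtain ⟨x, c, hx0, hstep, hfair⟩ := exists_fair_schedule
      (fun x : S => {C ∈ 𝒞 | B.Enabled x.1 C}) (fun x => hc x.1)
      (fun x => by obtain ⟨l, hl, hloc⟩ := x.2; exact hhalt l x.1 hl hloc) Q hQ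
      ⟨s, [], .nil _, by simp⟩
    choose hcC a ha hst using hstep
    refine ⟨⊤, fun n => (x n).1, a,
      { zero := by rw [hx0]
        steps := fun n _ => hst n
        pre := by simp
        length_le := by simp
        state_length := by simp [hx0]
        post := fun n _ _ => ⟨c n, hcC n, ha n⟩
        fair_fin := fun C _ n hn => absurd hn (by simp)
        fair_inf := ?_ }⟩
    · intro C hC _
      rcases hfair C with h | h
      · exact Or.inl (h.mono fun n hn => hn ▸ ha n)
      · exact Or.inr (h.mono fun n hn he => hn ⟨hC, he⟩)

/-- Every finite execution can be continued, by actions of the tasks in `𝒞` only, to an execution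
that is fair to these tasks. Only those tasks matter that are enabled in some state of the
execution, so it suffices that countably many are enabled in each state. -/
theorem Run.exists_exec [Nonempty Act] {B : IOAutomaton Act} (𝒞 : Set (Set Act))
    (hc : ∀ s, {C ∈ 𝒞 | B.Enabled s C}.Countable) {s l s'} (h₀ : s ∈ B.start)
    (h : B.Run s l s') :
    ∃ e : B.Exec, (l.length : ℕ∞) ≤ e.len ∧ e.state l.length = s' ∧
      (∀ n a, l[n]? = some a → e.Occurs n a) ∧
      (∀ n a, e.Occurs n a → l.length ≤ n → a ∈ ⋃₀ 𝒞) ∧ ∀ C ∈ 𝒞, e.FairTo C := by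
  obtain ⟨_, _, _, h1⟩ := B.exists_isFairFragment 𝒞 hc s'
  obtain ⟨len, state, act, h2⟩ := h1.append h
  rw [List.append_nil] at h2
  refine ⟨⟨len, state, act, h2.zero ▸ h₀, h2.steps⟩, h2.length_le, h2.state_length, h2.pre, ?_, ?_⟩
  · rintro n a ⟨hn, rfl⟩ hl
    exact h2.post n hl hn
  · exact fun C hC => ⟨h2.fair_fin C hC, h2.fair_inf C hC⟩

end IOAutomaton

/-! ### Finite executions of the message-passing system -/

section System

variable {k m l : ℕ} {V : Fin k → Type u} {D H : Type u}

open IOAutomaton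

/-- The process at which an action takes place. -/
def Act.loc : Act m l V D H → Proc k m l
  | .inv p _ => p
  | .resp p _ => p
  | .send p _ _ => p
  | .recv _ p _ => p
  | .internal p _ => p

/-- The client that is invoked by an action. -/
def Act.invoked? : Act m l V D H → Option (Proc k m l)
  | .inv p _ => some p
  | _ => none

/-- The clients that are invoked in a list of actions, in the order of the invocations. -/
def invokedClients (L : List (Act m l V D H)) : List (Proc k m l) := L.filterMap Act.invoked?

/-- The locally controlled actions of process `p`. -/
def IsLocal (p : Proc k m l) (a : Act m l V D H) : Prop := a ∈ procOut p ∪ procInt p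

theorem IsLocal.loc_eq {p : Proc k m l} {a : Act m l V D H} (h : IsLocal p a) : a.loc = p := by
  rcases h with (⟨_, _, rfl⟩ | ⟨_, _, _, rfl⟩) | ⟨_, rfl⟩ <;> rfl

theorem IsLocal.ne_inv {p : Proc k m l} {a : Act m l V D H} (h : IsLocal p a) {q t} :
    a ≠ .inv q t := by
  rintro rfl
  rcases h with (⟨_, _, h⟩ | ⟨_, _, _, h⟩) | ⟨_, h⟩ <;> cases h

theorem IsLocal.ne_recv {p : Proc k m l} {a : Act m l V D H} (h : IsLocal p a) {q q' msg} :
    a ≠ .recv q q' msg := by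
  rintro rfl
  rcases h with (⟨_, _, h⟩ | ⟨_, _, _, h⟩) | ⟨_, h⟩ <;> cases h

theorem IsLocal.invoked?_eq {p : Proc k m l} {a : Act m l V D H} (h : IsLocal p a) :
    a.invoked? = none := by
  rcases h with (⟨_, _, rfl⟩ | ⟨_, _, _, rfl⟩) | ⟨_, rfl⟩ <;> rfl

@[simp] theorem invokedClients_nil : invokedClients ([] : List (Act m l V D H)) = [] := rfl

theorem invokedClients_append (L L' : List (Act m l V D H)) :
    invokedClients (L ++ L') = invokedClients L ++ invokedClients L' := List.filterMap_append

theorem invokedClients_inv_cons (p : Proc k m l) (t : Invocation V) (L : List (Act m l V D H)) :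
    invokedClients (.inv p t :: L) = p :: invokedClients L := rfl

theorem invokedClients_recv_cons (p q : Proc k m l) (msg : Msg V D) (L : List (Act m l V D H)) :
    invokedClients (.recv p q msg :: L) = invokedClients L := rfl

theorem invokedClients_of_isLocal {p : Proc k m l} {L : List (Act m l V D H)}
    (h : ∀ a ∈ L, IsLocal p a) : invokedClients L = [] :=
  List.filterMap_eq_nil_iff.2 fun a ha => (h a ha).invoked?_eq

theorem mem_invokedClients {p : Proc k m l} {L : List (Act m l V D H)} :
    p ∈ invokedClients L ↔ ∃ t, Act.inv p t ∈ L := by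
  rw [invokedClients, List.mem_filterMap]
  constructor
  · rintro ⟨a, ha, h⟩
    cases a <;> simp only [Act.invoked?, reduceCtorEq, Option.some.injEq] at h
    subst h; exact ⟨_, ha⟩
  · rintro ⟨t, ht⟩; exact ⟨_, ht, rfl⟩

variable {A : Algorithm m l V D H}

namespace Algorithm

/-- The state of process `p` in a state of the system. -/
def procState (A : Algorithm m l V D H) (s : A.system.State) (p : Proc k m l) : (A.proc p).State :=
  s (.inl p)

/-- The messages in transit in the channel `pq`. -/
def chanState (A : Algorithm m l V D H) (s : A.system.State)
    (pq : {pq : Proc k m l × Proc k m l // pq.1 ≠ pq.2}) : Multiset (Msg V D) :=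
  s (.inr pq)

/-- The message `msg` is in transit from `p` to `q`. -/
def InTransit (A : Algorithm m l V D H) (s : A.system.State) (p q : Proc k m l) (msg : Msg V D) :
    Prop :=
  ∃ h : p ≠ q, msg ∈ A.chanState s ⟨(p, q), h⟩

theorem acts_proc (A : Algorithm m l V D H) (p : Proc k m l) :
    (A.proc p).acts = procInp p ∪ procOut p ∪ procInt p := by
  rw [acts, A.inp_eq, A.out_eq, A.int_eq]

theorem loc_of_mem_acts {p : Proc k m l} {a : Act m l V D H} (h : a ∈ (A.proc p).acts) :
    a.loc = p := by
  rw [acts_proc] at h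
  rcases h with (((⟨_, _, rfl⟩ | ⟨_, _, _, rfl⟩)) | h) | h
  · rfl
  · rfl
  · exact IsLocal.loc_eq (Or.inl h)
  · exact IsLocal.loc_eq (Or.inr h)

theorem mem_acts_of_isLocal {p : Proc k m l} {a : Act m l V D H} (h : IsLocal p a) :
    a ∈ (A.proc p).acts := by
  rw [acts_proc]
  rcases h with h | h
  · exact Or.inl (Or.inr h)
  · exact Or.inr h

theorem procState_eq_of_step {s s' : A.system.State} {a} (h : A.system.step s a s')
    {q : Proc k m l} (hq : a.loc ≠ q) : A.procState s' q = A.procState s q :=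
  (h.2 (.inl q)).2 fun hm => hq (loc_of_mem_acts hm)

theorem proc_step_of_step {s s' : A.system.State} {a} (h : A.system.step s a s')
    {p : Proc k m l} (ha : a ∈ (A.proc p).acts) :
    (A.proc p).step (A.procState s p) a (A.procState s' p) :=
  (h.2 (.inl p)).1 ha

theorem inTransit_of_step {s s' : A.system.State} {a} (h : A.system.step s a s')
    {p q : Proc k m l} {msg} (ha : a ≠ .recv p q msg) (ht : A.InTransit s p q msg) :
    A.InTransit s' p q msg := by
  obtain ⟨hpq, hm⟩ := ht
  refine ⟨hpq, ?_⟩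
  have h' := h.2 (.inr ⟨(p, q), hpq⟩)
  by_cases hmem : a ∈ (A.component (.inr ⟨(p, q), hpq⟩)).acts
  · obtain ⟨msg', ⟨-, hs⟩ | ⟨rfl, hs⟩⟩ := h'.1 hmem
    · replace hs : A.chanState s' _ = msg' ::ₘ A.chanState s _ := hs
      rw [hs]; exact Multiset.mem_cons_of_mem hm
    · replace hs : A.chanState s _ = msg' ::ₘ A.chanState s' _ := hs
      rw [hs] at hm
      rcases Multiset.mem_cons.1 hm with rfl | hm
      · exact absurd rfl ha
      · exact hm
  · rw [show A.chanState s' _ = A.chanState s _ from h'.2 hmem]; exact hm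

theorem inTransit_of_send {s s' : A.system.State} {p q : Proc k m l} {msg}
    (h : A.system.step s (.send p q msg) s') (hpq : p ≠ q) : A.InTransit s' p q msg := by
  refine ⟨hpq, ?_⟩
  have h' := (h.2 (.inr ⟨(p, q), hpq⟩)).1 (Or.inl (Or.inl ⟨msg, rfl⟩))
  obtain ⟨msg', ⟨he, hs⟩ | ⟨he, -⟩⟩ := h'
  · cases he
    rw [show A.chanState s' _ = msg ::ₘ A.chanState s _ from hs]
    exact Multiset.mem_cons_self _ _
  · cases he

/-- A step of a single process can be performed in the system, provided that the message is in
transit if the step is a receipt. -/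
theorem exists_step {s : A.system.State} {p : Proc k m l} {a t}
    (h : (A.proc p).step (A.procState s p) a t)
    (hrecv : ∀ q msg, a = .recv q p msg → A.InTransit s q p msg) :
    ∃ s', A.system.step s a s' ∧ A.procState s' p = t := by
  have hmem : a ∈ (A.proc p).acts := (A.proc p).step_mem _ _ _ h
  have hloc := loc_of_mem_acts hmem
  have key : ∀ c : Component k m l, ∃ t' : (A.component c).State,
      ((a ∈ (A.component c).acts → (A.component c).step (s c) a t') ∧
        (a ∉ (A.component c).acts → t' = s c)) ∧
      ∀ hc : Sum.inl p = c, t' = hc ▸ (show (A.component (.inl p)).State from t) := by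
    rintro (q | ⟨⟨x, y⟩, hxy⟩)
    · by_cases hq : p = q
      · subst hq
        exact ⟨t, ⟨fun _ => h, fun hn => absurd hmem hn⟩, fun _ => rfl⟩
      · exact ⟨s (.inl q), ⟨fun hn => absurd (hloc.symm.trans (loc_of_mem_acts hn)) hq,
          fun _ => rfl⟩, fun hc => absurd (Sum.inl.inj hc) hq⟩
    · by_cases hc : a ∈ (A.component (.inr ⟨(x, y), hxy⟩)).acts
      · rcases hc with (⟨msg, rfl⟩ | ⟨msg, rfl⟩) | hc
        · exact ⟨_, ⟨fun _ => ⟨msg, Or.inl ⟨rfl, rfl⟩⟩,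
            fun hn => absurd (Or.inl (Or.inl ⟨msg, rfl⟩)) hn⟩, fun hc => by cases hc⟩
        · obtain rfl : y = p := hloc
          obtain ⟨_, hm⟩ := hrecv x msg rfl
          obtain ⟨t', ht'⟩ := Multiset.exists_cons_of_mem hm
          exact ⟨t', ⟨fun _ => ⟨msg, Or.inr ⟨rfl, ht'⟩⟩,
            fun hn => absurd (Or.inl (Or.inr ⟨msg, rfl⟩)) hn⟩, fun hc => by cases hc⟩
        · exact absurd hc (Set.notMem_empty _)
      · exact ⟨_, ⟨fun hn => absurd hn hc, fun _ => rfl⟩, fun hc => by cases hc⟩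
  choose s' h1 h2 using key
  exact ⟨s', ⟨⟨.inl p, hmem⟩, h1⟩, h2 (.inl p) rfl⟩

theorem procState_eq_of_run {s s' : A.system.State} {L} (h : A.system.Run s L s')
    {q : Proc k m l} (hq : ∀ a ∈ L, a.loc ≠ q) : A.procState s' q = A.procState s q := by
  induction h with
  | nil => rfl
  | cons hs _ ih =>
    rw [ih fun a ha => hq a (List.mem_cons_of_mem _ ha),
      procState_eq_of_step hs (hq _ List.mem_cons_self)]

theorem inTransit_of_run {s s' : A.system.State} {L} (h : A.system.Run s L s')
    {p q : Proc k m l} {msg} (ha : Act.recv p q msg ∉ L) (ht : A.InTransit s p q msg) :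
    A.InTransit s' p q msg := by
  induction h with
  | nil => exact ht
  | cons hs _ ih =>
    rw [List.mem_cons, not_or] at ha
    exact ih ha.2 (inTransit_of_step hs (Ne.symm ha.1) ht)

theorem inTransit_of_send_mem {s s' : A.system.State} {L} (h : A.system.Run s L s')
    {p q : Proc k m l} {msg} (hpq : p ≠ q) (ha : Act.recv p q msg ∉ L)
    (hs : Act.send p q msg ∈ L) : A.InTransit s' p q msg := by
  induction h with
  | nil => cases hs
  | cons hst hl ih =>
    rw [List.mem_cons, not_or] at ha
    rcases List.mem_cons.1 hs with rfl | hs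
    · exact inTransit_of_run hl ha.2 (inTransit_of_send hst hpq)
    · exact ih ha.2 hs

theorem proc_run_of_run {s s' : A.system.State} {L} (h : A.system.Run s L s')
    {p : Proc k m l} (hL : ∀ a ∈ L, IsLocal p a) :
    (A.proc p).Run (A.procState s p) L (A.procState s' p) := by
  induction h with
  | nil => exact .nil _
  | cons hs _ ih =>
    exact .cons (proc_step_of_step hs (mem_acts_of_isLocal (hL _ List.mem_cons_self)))
      (ih fun a ha => hL a (List.mem_cons_of_mem _ ha))

/-- A process can take its locally controlled steps in the system, whatever the states of the other
components are. -/
theorem exists_run {p : Proc k m l} {t L t'} (h : (A.proc p).Run t L t')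
    (hL : ∀ a ∈ L, IsLocal p a) {s : A.system.State} (hs : A.procState s p = t) :
    ∃ s', A.system.Run s L s' ∧ A.procState s' p = t' := by
  induction h generalizing s with
  | nil => exact ⟨s, .nil _, hs⟩
  | cons hst _ ih =>
    subst hs
    obtain ⟨s₁, h1, h2⟩ := exists_step hst fun q msg he =>
      absurd he (hL _ List.mem_cons_self).ne_recv
    obtain ⟨s₂, h3, h4⟩ := ih (fun a ha => hL a (List.mem_cons_of_mem _ ha)) h2
    exact ⟨s₂, .cons h1 h3, h4⟩

end Algorithm

instance : Countable (Proc k m l) :=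
  Function.Injective.countable (β := Fin k ⊕ Fin m ⊕ Fin l)
    (f := fun p => match p with
      | .server i => .inl i
      | .reader r => .inr (.inl r)
      | .writer w => .inr (.inr w))
    (by rintro (_ | _ | _) (_ | _ | _) h <;> simp_all)

/-- In each state only countably many tasks are enabled: a channel has one task for every
message, but only those for the messages in transit are enabled. -/
theorem Algorithm.countable_enabled (A : Algorithm m l V D H) (s : A.system.State) :
    {C ∈ A.system.tasks | A.system.Enabled s C}.Countable := by
  have h : ((⋃ p, (A.proc p).tasks) ∪ ⋃ pq : {pq : Proc k m l × Proc k m l // pq.1 ≠ pq.2},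
      (fun msg => ({Act.recv pq.1.1 pq.1.2 msg} : Set (Act m l V D H))) ''
        {msg | msg ∈ A.chanState s pq}).Countable :=
    (Set.countable_iUnion A.tasks_countable).union
      (Set.countable_iUnion fun pq => ((Multiset.finite_toSet _).countable.image _))
  refine h.mono ?_
  rintro C ⟨hC, a, ha, s', hs'⟩
  obtain ⟨p | pq, hp⟩ := Set.mem_iUnion.1 hC
  · exact Or.inl (Set.mem_iUnion.2 ⟨p, hp⟩)
  · obtain ⟨msg, rfl⟩ := hp
    refine Or.inr (Set.mem_iUnion.2 ⟨pq, msg, ?_, rfl⟩)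
    obtain rfl := Set.mem_singleton_iff.1 ha
    obtain ⟨msg', ⟨he, -⟩ | ⟨he, hs⟩⟩ := (hs'.2 (.inr pq)).1 (Or.inl (Or.inr ⟨msg, rfl⟩))
    · cases he
    · cases he
      show msg ∈ A.chanState s pq
      rw [show A.chanState s _ = msg ::ₘ A.chanState s' _ from hs]
      exact Multiset.mem_cons_self _ _

/-- The actions `L` lead from a start state of the system to the state `s`, and every client is
invoked at most once. -/
def Reaches (A : Algorithm m l V D H) (L : List (Act m l V D H)) (s : A.system.State) : Prop :=
  (∃ s₀ ∈ A.system.start, A.system.Run s₀ L s) ∧ (invokedClients L).Nodup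

/-- The execution starts with the actions `L`, leading to `s`, and no invocations occur after
that; every client is invoked at most once. -/
structure Extends (e : A.Exec) (L : List (Act m l V D H)) (s : A.system.State) : Prop where
  length_le : (L.length : ℕ∞) ≤ e.len
  state_length : e.state L.length = s
  occurs : ∀ n a, L[n]? = some a → e.Occurs n a
  inv_lt : ∀ n p t, e.Occurs n (.inv p t) → n < L.length
  nodup : (invokedClients L).Nodup

theorem Extends.getElem? {e : A.Exec} {L s} (h : Extends e L s) {n a} (ho : e.Occurs n a)
    (hn : n < L.length) : L[n]? = some a := by
  have := (h.occurs n L[n] (by simp [hn])).2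
  rw [List.getElem?_eq_getElem hn, ← this, ho.2]

theorem Extends.mem {e : A.Exec} {L s} (h : Extends e L s) {n a} (ho : e.Occurs n a)
    (hn : n < L.length) : a ∈ L := List.mem_of_getElem? (h.getElem? ho hn)

theorem Extends.inv_unique {e : A.Exec} {L s} (h : Extends e L s) {p t t' n n'}
    (h1 : e.Occurs n (.inv p t)) (h2 : e.Occurs n' (.inv p t')) : ¬ n < n' := by
  intro hlt
  have hn' := h.inv_lt _ _ _ h2
  have hp := List.pairwise_filterMap.1 h.nodup
  rw [List.pairwise_iff_getElem] at hp
  have g1 := h.getElem? h1 (hlt.trans hn')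
  have g2 := h.getElem? h2 hn'
  rw [List.getElem?_eq_getElem (hlt.trans hn'), Option.some.injEq] at g1
  rw [List.getElem?_eq_getElem hn', Option.some.injEq] at g2
  exact hp n n' (hlt.trans hn') hn' hlt p (by rw [g1]; rfl) p (by rw [g2]; rfl) rfl

theorem Extends.wellFormed {e : A.Exec} {L s} (h : Extends e L s) : WellFormed e :=
  fun _ _ _ _ _ hlt h1 h2 => absurd hlt (h.inv_unique h1 h2)

/-- A finite execution can be continued by locally controlled actions of process `p` only, fairly
to `p`. -/
theorem Reaches.exists_fairFor {L} {s : A.system.State} (h : Reaches A L s) (p : Proc k m l) :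
    ∃ e : A.Exec, Extends e L s ∧ FairFor e p ∧
      ∀ n a, e.Occurs n a → L.length ≤ n → IsLocal p a := by
  obtain ⟨⟨s₀, h0, hr⟩, hnd⟩ := h
  have : Nonempty (Act m l V D H) := ⟨.resp p .ack⟩
  obtain ⟨e, h1, h2, h3, h4, h5⟩ := hr.exists_exec (A.proc p).tasks
    (fun s => (A.tasks_countable p).mono fun C hC => hC.1) h0
  have h6 : ∀ n a, e.Occurs n a → L.length ≤ n → IsLocal p a := fun n a ho hn => by
    have := h4 n a ho hn
    rwa [(A.proc p).tasks_cover, A.out_eq, A.int_eq] at this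
  exact ⟨e, ⟨h1, h2, h3, fun n q t ho => not_le.1 fun hn => (h6 n _ ho hn).ne_inv rfl, hnd⟩, h5, h6⟩

/-- A finite execution can be continued to a fair execution without further invocations. -/
theorem Reaches.exists_fair [Nonempty (Proc k m l)] {L} {s : A.system.State} (h : Reaches A L s) :
    ∃ e : A.Exec, Extends e L s ∧ e.Fair := by
  obtain ⟨⟨s₀, h0, hr⟩, hnd⟩ := h
  have : Nonempty (Act m l V D H) := ⟨.resp (Classical.arbitrary _) .ack⟩
  obtain ⟨e, h1, h2, h3, h4, h5⟩ := hr.exists_exec A.system.tasks A.countable_enabled h0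
  refine ⟨e, ⟨h1, h2, h3, fun n q t ho => not_le.1 fun hn => ?_, hnd⟩, h5⟩
  have := h4 n _ ho hn
  rw [A.system.tasks_cover] at this
  rcases this with h | h
  · obtain ⟨p | pq, hp⟩ := Set.mem_iUnion.1 h
    · have hp : _ ∈ (A.proc p).out := hp
      rw [A.out_eq] at hp
      exact IsLocal.ne_inv (p := p) (Or.inl hp) rfl
    · obtain ⟨_, hp⟩ := hp
      cases hp
  · obtain ⟨p | pq, hp⟩ := Set.mem_iUnion.1 h
    · have hp : _ ∈ (A.proc p).int := hp
      rw [A.int_eq] at hp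
      exact IsLocal.ne_inv (p := p) (Or.inr hp) rfl
    · exact hp

theorem Reaches.append {L L'} {s s' : A.system.State} (h : Reaches A L s)
    (h' : A.system.Run s L' s') (hnd : (invokedClients (L ++ L')).Nodup) :
    Reaches A (L ++ L') s' := by
  obtain ⟨⟨s₀, h0, hr⟩, -⟩ := h
  exact ⟨⟨s₀, h0, hr.append h'⟩, hnd⟩

theorem Reaches.append_of_nil {L L'} {s s' : A.system.State} (h : Reaches A L s)
    (h' : A.system.Run s L' s') (hnil : invokedClients L' = []) :
    Reaches A (L ++ L') s' :=
  h.append h' (by rw [invokedClients_append, hnil, List.append_nil]; exact h.2)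

/-- An execution in which process `p` alone runs after the actions `L` yields a run of `p`, in which
all actions of the execution up to position `N` occur. -/
theorem Extends.exists_local_run {e : A.Exec} {L s} (h : Extends e L s) {p : Proc k m l}
    (hloc : ∀ n a, e.Occurs n a → L.length ≤ n → IsLocal p a) (N : ℕ) :
    ∃ L' t, (A.proc p).Run (A.procState s p) L' t ∧ (∀ a ∈ L', IsLocal p a) ∧
      ∀ n a, L.length ≤ n → n < N → e.Occurs n a → a ∈ L' := by
  -- the last position below `N` that belongs to the execution
  obtain ⟨K, hK, hmax⟩ : ∃ K, ((L.length + K : ℕ) : ℕ∞) ≤ e.len ∧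
      ∀ n, L.length ≤ n → n < N → (n : ℕ∞) < e.len → n < L.length + K := by
    have h0 : ((L.length + 0 : ℕ) : ℕ∞) ≤ e.len := h.length_le
    by_cases hlen : (N : ℕ∞) ≤ e.len
    · by_cases hN : L.length ≤ N
      · exact ⟨N - L.length, by rwa [Nat.add_sub_cancel' hN], fun n _ hn _ => by omega⟩
      · exact ⟨0, h0, fun n _ hn _ => by omega⟩
    · obtain ⟨M, hM⟩ := ENat.ne_top_iff_exists.1 (ne_top_of_lt (not_le.1 hlen))
      have hLM : L.length ≤ M := by have := h.length_le; rw [← hM] at this; exact_mod_cast this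
      refine ⟨M - L.length, by rw [Nat.add_sub_cancel' hLM, hM], fun n _ _ hn => ?_⟩
      rw [← hM] at hn
      have : n < M := by exact_mod_cast hn
      omega
  have hrun := e.run L.length K hK
  have hL' : ∀ a ∈ (List.range' L.length K).map e.act, IsLocal p a := by
    intro a ha
    obtain ⟨n, hn, rfl⟩ := List.mem_map.1 ha
    rw [List.mem_range'_1] at hn
    exact hloc n _ ⟨lt_of_lt_of_le (by exact_mod_cast hn.2) hK, rfl⟩ hn.1
  have hrun' := Algorithm.proc_run_of_run hrun hL'
  rw [h.state_length] at hrun'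
  refine ⟨_, _, hrun', hL', ?_⟩
  · rintro n a h1 h2 ⟨h3, rfl⟩
    exact List.mem_map_of_mem (List.mem_range'_1.2 ⟨h1, hmax n h1 h2 h3⟩)

end System

section System

variable {k m l : ℕ} {V : Fin k → Type u} {D H : Type u} {A : Algorithm m l V D H}

open IOAutomaton

theorem IsLocal.notMem_procInp {p q : Proc k m l} {a : Act m l V D H} (h : IsLocal p a) :
    a ∉ procInp q := by
  rintro (⟨_, _, rfl⟩ | ⟨_, _, _, rfl⟩)
  · exact h.ne_inv rfl
  · exact h.ne_recv rfl

theorem Algorithm.exists_input_step (A : Algorithm m l V D H) {p : Proc k m l}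
    {a : Act m l V D H} (ha : a ∈ procInp p) (t : (A.proc p).State) :
    ∃ t', (A.proc p).step t a t' :=
  (A.proc p).input_enabled t a (by rw [A.inp_eq]; exact ha)

/-- The first `n` actions of an execution. -/
def prefixActs (e : A.Exec) (n : ℕ) : List (Act m l V D H) := (List.range' 0 n).map e.act

theorem mem_prefixActs {e : A.Exec} {n : ℕ} (hn : (n : ℕ∞) ≤ e.len) {a} :
    a ∈ prefixActs e n ↔ ∃ i < n, e.Occurs i a := by
  simp only [prefixActs, List.mem_map, List.mem_range'_1]
  constructor
  · rintro ⟨i, hi, rfl⟩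
    have : i < n := by omega
    exact ⟨i, this, lt_of_lt_of_le (by exact_mod_cast this) hn, rfl⟩
  · rintro ⟨i, hi, -, rfl⟩
    exact ⟨i, by omega, rfl⟩

theorem Extends.reaches_prefix {e : A.Exec} {L s} (h : Extends e L s) {n : ℕ}
    (hn : (n : ℕ∞) ≤ e.len) : Reaches A (prefixActs e n) (e.state n) := by
  refine ⟨⟨_, e.init, by simpa [prefixActs] using e.run 0 n (by simpa using hn)⟩, ?_⟩
  refine List.pairwise_filterMap.2 (List.pairwise_iff_getElem.2 ?_)
  intro i j hi hj hij p hp q hq hpq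
  subst hpq
  simp only [prefixActs, List.length_map, List.length_range', List.getElem_map,
    List.getElem_range', zero_add, one_mul] at hi hj hp hq
  have hlt : ∀ i < n, (i : ℕ∞) < e.len := fun i hi => lt_of_lt_of_le (by exact_mod_cast hi) hn
  have key : ∀ i < n, (e.act i).invoked? = some p → ∃ t, e.Occurs i (.inv p t) := by
    intro i hi hp
    cases ha : e.act i <;> rw [ha] at hp <;>
      simp only [Act.invoked?, reduceCtorEq, Option.some.injEq] at hp
    subst hp; exact ⟨_, hlt i hi, ha⟩
  obtain ⟨t, ht⟩ := key i hi hp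
  obtain ⟨t', ht'⟩ := key j hj hq
  exact h.inv_unique ht ht' hij

/-- In a serialization, a transaction that is completed before another one is invoked comes
earlier. -/
theorem Serialization.exists_lt {v₀ : ∀ i, V i} {e : A.Exec} (S : Serialization v₀ e)
    (hW : ConcurrentWrites A) (hf : e.Fair) (hwf : WellFormed e) {n c p t ρ} {j : ℕ}
    (hn : e.Occurs n (.inv p t)) (hc : e.Occurs c (.resp p ρ)) (hnc : n < c)
    (hj : (j : ℕ∞) < S.len) (hcj : c < S.pos j) : ∃ j' < j, S.pos j' = n := by
  obtain ⟨i, ρ', hi⟩ := hW e hf hwf p t n hn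
  have hic : i ≤ c := not_lt.1 fun h => hi.2.2 c ρ hnc h hc
  obtain ⟨j', hj', rfl⟩ := S.complete n p t i ρ' hn hi
  have h1 := (S.before_resp j' hj' p t i ρ' hn hi).1
  have h2 := S.after_inv j hj
  have h3 : (i : ℝ) < S.pos j := by exact_mod_cast hic.trans_lt hcj
  refine ⟨j', not_le.1 fun hle => ?_, rfl⟩
  rcases hle.lt_or_eq with h | h
  · have := S.ordered j j' h hj'; linarith
  · subst h; linarith

end System

/-! ### Two servers, two readers, one writer -/

section TwoReaders

variable {V : Fin 2 → Type u} {D H : Type u} {A : Algorithm 2 1 V D H}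

open IOAutomaton

/-- The READ of both objects. -/
def readAll : Invocation V := .read Finset.univ Finset.univ_nonempty

/-- The WRITE of the values `x` to both objects. -/
def writeAll (x : ∀ i, V i) : Invocation V := .write (fun i => some (x i)) ⟨0, by simp⟩

/-- The transaction that a client performs in the executions considered: the writer writes `x`,
the readers read both objects. -/
def txn (x : ∀ i, V i) : Proc 2 2 1 → Invocation V
  | .writer _ => writeAll x
  | _ => readAll

/-- The actions `L` lead from a start state to the state `s`; every client is invoked at most once,
with the transaction `txn x`. -/
structure History (x : ∀ i, V i) (A : Algorithm 2 1 V D H) (L : List (Act 2 1 V D H))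
    (s : A.system.State) : Prop where
  reaches : Reaches A L s
  txn_eq : ∀ p t, Act.inv p t ∈ L → t = txn x p

variable {v₀ x : ∀ i, V i}

theorem History.append {L L' : List (Act 2 1 V D H)} {s s' : A.system.State}
    (h : History x A L s) (h' : A.system.Run s L' s') (hnil : invokedClients L' = []) :
    History x A (L ++ L') s' := by
  refine ⟨h.reaches.append_of_nil h' hnil, fun p t hm => ?_⟩
  rcases List.mem_append.1 hm with hm | hm
  · exact h.txn_eq p t hm
  · have := mem_invokedClients.2 ⟨t, hm⟩
    rw [hnil] at this; cases this

theorem History.append_inv {L L' : List (Act 2 1 V D H)} {s s' : A.system.State}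
    (h : History x A L s) {p} (hp : p ∉ invokedClients L)
    (h' : A.system.Run s (.inv p (txn x p) :: L') s') (hnil : invokedClients L' = []) :
    History x A (L ++ .inv p (txn x p) :: L') s' := by
  refine ⟨h.reaches.append h' ?_, fun q t hm => ?_⟩
  · rw [invokedClients_append, invokedClients_inv_cons, hnil]
    exact List.nodup_append.2 ⟨h.reaches.2, by simp, by
      rintro a ha b hb rfl
      rw [List.mem_singleton.1 hb] at ha
      exact hp ha⟩
  · rcases List.mem_append.1 hm with hm | hm
    · exact h.txn_eq q t hm
    · rcases List.mem_cons.1 hm with hm | hm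
      · cases hm; rfl
      · have := mem_invokedClients.2 ⟨t, hm⟩
        rw [hnil] at this; cases this

theorem History.txn_of_occurs {L : List (Act 2 1 V D H)} {s : A.system.State}
    (h : History x A L s) {e : A.Exec} (he : Extends e L s) {n p t}
    (ho : e.Occurs n (.inv p t)) : t = txn x p :=
  h.txn_eq p t (he.mem ho (he.inv_lt n p t ho))

instance : Nonempty (Proc 2 2 1) := ⟨.server 0⟩

/-- Starting in the state `ρ`, reader `r` is invoked and performs the locally controlled actions
`L`, which lead to `ρ'` and send the read request `d i` to each server `i`. -/
structure ReadStart (A : Algorithm 2 1 V D H) (r : Fin 2) (ρ : (A.proc (.reader r)).State)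
    (L : List (Act 2 1 V D H)) (ρ' : (A.proc (.reader r)).State) (d : Fin 2 → D) : Prop where
  run : ∃ ρ₀, (A.proc (.reader r)).step ρ (.inv (.reader r) readAll) ρ₀ ∧
    (A.proc (.reader r)).Run ρ₀ L ρ'
  isLocal : ∀ a ∈ L, IsLocal (.reader r) a
  sends : ∀ i, Act.send (.reader r) (.server i) (.readReq (d i)) ∈ L

/-- Starting in the state `σ`, server `i` receives the read request `d` of reader `r` and performs
the locally controlled actions `L`, which lead to `σ'` and send an answer with the value `v` to
`r`. -/
structure ServerAnswer (A : Algorithm 2 1 V D H) (i r : Fin 2) (σ : (A.proc (.server i)).State)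
    (d : D) (L : List (Act 2 1 V D H)) (σ' : (A.proc (.server i)).State) (v : V i) : Prop where
  run : ∃ σ₀, (A.proc (.server i)).step σ (.recv (.reader r) (.server i) (.readReq d)) σ₀ ∧
    (A.proc (.server i)).Run σ₀ L σ'
  isLocal : ∀ a ∈ L, IsLocal (.server i) a
  answer : ∃ d', Act.send (.server i) (.reader r) (.value i v d') ∈ L

theorem readAll_mem_procInp (r : Fin 2) :
    (.inv (.reader r) readAll : Act 2 1 V D H) ∈ procInp (.reader r) :=
  Or.inl ⟨readAll, trivial, rfl⟩

theorem ReadStart.exists_run {r L d} {s : A.system.State} {ρ'}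
    (h : ReadStart A r (A.procState s (.reader r)) L ρ' d) :
    ∃ s', A.system.Run s (.inv (.reader r) readAll :: L) s' ∧
      (∀ q, q ≠ .reader r → A.procState s' q = A.procState s q) ∧
      ∀ i, A.InTransit s' (.reader r) (.server i) (.readReq (d i)) := by
  obtain ⟨ρ₀, h1, h2⟩ := h.run
  obtain ⟨s₁, h3, h4⟩ := Algorithm.exists_step h1 (fun _ _ he => by cases he)
  obtain ⟨s₂, h5, -⟩ := Algorithm.exists_run h2 h.isLocal h4
  have hrun := Run.cons h3 h5
  refine ⟨s₂, hrun, fun q hq => Algorithm.procState_eq_of_run hrun ?_, fun i => ?_⟩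
  · intro a ha
    rcases List.mem_cons.1 ha with rfl | ha
    · exact hq.symm
    · rw [(h.isLocal a ha).loc_eq]; exact hq.symm
  · exact Algorithm.inTransit_of_send_mem h5 (by simp) (fun hm => (h.isLocal _ hm).ne_recv rfl)
      (h.sends i)

theorem ServerAnswer.exists_run {i r d L v} {s : A.system.State} {σ'}
    (h : ServerAnswer A i r (A.procState s (.server i)) d L σ' v)
    (ht : A.InTransit s (.reader r) (.server i) (.readReq d)) :
    ∃ s', A.system.Run s (.recv (.reader r) (.server i) (.readReq d) :: L) s' ∧
      A.procState s' (.server i) = σ' ∧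
      (∀ q, q ≠ .server i → A.procState s' q = A.procState s q) ∧
      (∀ p q msg, q ≠ .server i → A.InTransit s p q msg → A.InTransit s' p q msg) ∧
      ∃ d', Act.send (.server i) (.reader r) (.value i v d') ∈ L ∧
        A.InTransit s' (.server i) (.reader r) (.value i v d') := by
  obtain ⟨σ₀, h1, h2⟩ := h.run
  obtain ⟨s₁, h3, h4⟩ := Algorithm.exists_step h1 (fun _ _ he => by cases he; exact ht)
  obtain ⟨s₂, h5, h6⟩ := Algorithm.exists_run h2 h.isLocal h4
  have hrun := Run.cons h3 h5
  obtain ⟨d', hd'⟩ := h.answer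
  refine ⟨s₂, hrun, h6, fun q hq => Algorithm.procState_eq_of_run hrun ?_, fun p q msg hq => ?_,
    d', hd', ?_⟩
  · intro a ha
    rcases List.mem_cons.1 ha with rfl | ha
    · exact hq.symm
    · rw [(h.isLocal a ha).loc_eq]; exact hq.symm
  · refine Algorithm.inTransit_of_run hrun fun hm => ?_
    rcases List.mem_cons.1 hm with hm | hm
    · cases hm; exact hq rfl
    · exact (h.isLocal _ hm).ne_recv rfl
  · exact Algorithm.inTransit_of_send_mem h5 (by simp) (fun hm => (h.isLocal _ hm).ne_recv rfl) hd'

theorem exists_readStart (hR : ReadersDoNotWait A) {L} {s : A.system.State}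
    (h : History x A L s) {r} (hr : .reader r ∉ invokedClients L) :
    ∃ L' ρ' d, ReadStart A r (A.procState s (.reader r)) L' ρ' d := by
  obtain ⟨ρ₀, h1⟩ := A.exists_input_step (readAll_mem_procInp r) (A.procState s (.reader r))
  obtain ⟨s₁, h3, rfl⟩ := Algorithm.exists_step h1 (fun _ _ he => by cases he)
  have h4 := h.append_inv hr (Run.singleton h3) rfl
  obtain ⟨e, he, hf, hloc⟩ := h4.reaches.exists_fairFor (.reader r)
  have hlen : (L ++ [Act.inv (.reader r) (txn x (.reader r))]).length = L.length + 1 := by simp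
  have hn : e.Occurs L.length (.inv (.reader r) readAll) := he.occurs _ _ (by simp [txn])
  have hno : NoInputAfter e (.reader r) L.length := fun j a hj ho =>
    (hloc j a ho (by omega)).notMem_procInp
  choose j d hj hjd using fun i =>
    hR e he.wellFormed r hf _ _ _ hn hno i (Finset.mem_univ i)
  obtain ⟨L', t, h5, h6, h7⟩ := he.exists_local_run hloc (j 0 + j 1 + 1)
  refine ⟨L', t, d, ⟨_, h1, h5⟩, h6, fun i => h7 (j i) _ ?_ ?_ (hjd i)⟩
  · have := hj i; omega
  · have h0 : j i ≤ j 0 + j 1 := by fin_cases i <;> simp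
    omega

theorem exists_serverAnswer_of_inTransit (hN : NonBlocking A) {L} {s : A.system.State}
    (h : History x A L s) {r i d}
    (ht : A.InTransit s (.reader r) (.server i) (.readReq d)) :
    ∃ L' σ' v, ServerAnswer A i r (A.procState s (.server i)) d L' σ' v := by
  have hin : (.recv (.reader r) (.server i) (.readReq d) : Act 2 1 V D H) ∈ procInp (.server i) :=
    Or.inr ⟨_, _, by simp, rfl⟩
  obtain ⟨σ₀, h1⟩ := A.exists_input_step hin (A.procState s (.server i))
  obtain ⟨s₁, h3, rfl⟩ := Algorithm.exists_step h1 (fun _ _ he => by cases he; exact ht)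
  have h4 := h.append (Run.singleton h3) rfl
  obtain ⟨e, he, hf, hloc⟩ := h4.reaches.exists_fairFor (.server i)
  have hlen : (L ++ [(.recv (.reader r) (.server i) (.readReq d) : Act 2 1 V D H)]).length
    = L.length + 1 := by simp
  have hn : e.Occurs L.length (.recv (.reader r) (.server i) (.readReq d)) :=
    he.occurs _ _ (by simp)
  have hno : NoInputAfter e (.server i) L.length := fun j a hj ho =>
    (hloc j a ho (by omega)).notMem_procInp
  obtain ⟨j, v, d', hj, ho⟩ := hN e he.wellFormed i r hf _ _ hn hno
  obtain ⟨L', t, h5, h6, h7⟩ := he.exists_local_run hloc (j + 1)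
  exact ⟨L', t, v, ⟨_, h1, h5⟩, h6, d', h7 j _ (by omega) (by omega) ho⟩

theorem History.append_readStart {L L' : List (Act 2 1 V D H)} {s s' : A.system.State}
    (h : History x A L s) {r} (hr : .reader r ∉ invokedClients L)
    (h' : A.system.Run s (.inv (.reader r) readAll :: L') s') (hnil : invokedClients L' = []) :
    History x A (L ++ .inv (.reader r) readAll :: L') s' :=
  h.append_inv hr h' hnil

/-- Every server answers the request of a READ, even if it runs before anything else happens. -/
theorem exists_serverAnswer (hN : NonBlocking A) {L} {s : A.system.State}
    (h : History x A L s) {r} (hr : .reader r ∉ invokedClients L) {L' ρ' d}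
    (hs : ReadStart A r (A.procState s (.reader r)) L' ρ' d) (i) :
    ∃ La σ' v, ServerAnswer A i r (A.procState s (.server i)) (d i) La σ' v := by
  obtain ⟨s', h1, h2, h3⟩ := hs.exists_run
  rw [← h2 _ (by simp)]
  exact exists_serverAnswer_of_inTransit hN
    (h.append_readStart hr h1 (invokedClients_of_isLocal hs.isLocal)) (h3 i)

/-- A given answer of one server can be complemented by answers of the other one. -/
theorem exists_serverAnswers (hN : NonBlocking A) {L} {s : A.system.State}
    (h : History x A L s) {r} (hr : .reader r ∉ invokedClients L) {L' ρ' d}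
    (hs : ReadStart A r (A.procState s (.reader r)) L' ρ' d) {i La σ' v}
    (ha : ServerAnswer A i r (A.procState s (.server i)) (d i) La σ' v) :
    ∃ (La : Fin 2 → _) (σ' : ∀ _, _) (w : ∀ j, V j),
      (∀ j, ServerAnswer A j r (A.procState s (.server j)) (d j) (La j) (σ' j) (w j)) ∧
      w i = v := by
  have key : ∀ j, ∃ La σ' w, ServerAnswer A j r (A.procState s (.server j)) (d j) La σ' w ∧
      ∀ hij : i = j, w = hij ▸ v := by
    intro j
    by_cases hij : i = j
    · subst hij; exact ⟨La, σ', v, ha, fun _ => rfl⟩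
    · obtain ⟨La, σ', w, hw⟩ := exists_serverAnswer hN h hr hs j
      exact ⟨La, σ', w, hw, fun he => absurd he hij⟩
  choose La σ' w h1 h2 using key
  exact ⟨La, σ', w, h1, h2 i rfl⟩

/-- In the list `B` of actions, the servers send the values `v` to reader `r`, which receives
nothing. -/
def SendsAnswers (B : List (Act 2 1 V D H)) (r : Fin 2) (v : ∀ i, V i) : Prop :=
  (∀ p msg, Act.recv p (.reader r) msg ∉ B) ∧
    ∀ i, ∃ d, Act.send (.server i) (.reader r) (.value i (v i) d) ∈ B

/-- A READ is started, and both servers answer in turn. -/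
theorem exists_run_sendsAnswers {s : A.system.State} {r L ρ' d}
    (hs : ReadStart A r (A.procState s (.reader r)) L ρ' d) {La : Fin 2 → _} {σ' : ∀ _, _}
    {v : ∀ j, V j}
    (ha : ∀ j, ServerAnswer A j r (A.procState s (.server j)) (d j) (La j) (σ' j) (v j)) :
    ∃ B s', A.system.Run s (.inv (.reader r) readAll :: B) s' ∧ invokedClients B = [] ∧
      SendsAnswers B r v ∧ (∀ i, A.procState s' (.server i) = σ' i) ∧
      (∀ r', r' ≠ r → A.procState s' (.reader r') = A.procState s (.reader r')) ∧
      ∀ i, ∃ d, A.InTransit s' (.server i) (.reader r) (.value i (v i) d) := by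
  obtain ⟨s₁, h1, h2, h3⟩ := hs.exists_run
  have ha0 := ha 0
  have ha1 := ha 1
  rw [← h2 _ (by simp)] at ha0
  obtain ⟨s₂, k1, k2, k3, k4, d0, k5, k6⟩ := ha0.exists_run (h3 0)
  rw [← h2 _ (by simp), ← k3 _ (by simp)] at ha1
  obtain ⟨s₃, m1, m2, m3, m4, d1, m5, m6⟩ := ha1.exists_run (k4 _ _ _ (by simp) (h3 1))
  have hrun := (h1.append k1).append m1
  rw [List.append_assoc, List.cons_append] at hrun
  refine ⟨L ++ (.recv (.reader r) (.server 0) (.readReq (d 0)) :: La 0 ++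
    .recv (.reader r) (.server 1) (.readReq (d 1)) :: La 1), s₃, hrun, ?_, ⟨?_, ?_⟩, ?_, ?_, ?_⟩
  · simp only [invokedClients_append, invokedClients_recv_cons,
      invokedClients_of_isLocal hs.isLocal, invokedClients_of_isLocal (ha 0).isLocal,
      invokedClients_of_isLocal (ha 1).isLocal, List.append_nil]
  · intro p msg hm
    simp only [List.mem_append, List.mem_cons] at hm
    rcases hm with hm | (hm | hm) | hm | hm
    · exact (hs.isLocal _ hm).ne_recv rfl
    · cases hm
    · exact ((ha 0).isLocal _ hm).ne_recv rfl
    · cases hm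
    · exact ((ha 1).isLocal _ hm).ne_recv rfl
  · intro i
    fin_cases i
    · exact ⟨d0, by simp [k5]⟩
    · exact ⟨d1, by simp [m5]⟩
  · intro i
    fin_cases i
    · exact (m3 _ (by simp)).trans k2
    · exact m2
  · intro r' hr'
    rw [m3 _ (by simp), k3 _ (by simp), h2 _ (by simpa using hr')]
  · intro i
    fin_cases i
    · exact ⟨d0, m4 _ _ _ (by simp) k6⟩
    · exact ⟨d1, m6⟩

/-! ### Serializations -/

theorem Serialization.value_succ {e : A.Exec} (S : Serialization v₀ e)
    (ht : ∀ n p t, e.Occurs n (.inv p t) → t = txn x p) {j : ℕ} (hj : (j : ℕ∞) < S.len) :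
    S.value (j + 1) = S.value j ∧ ¬ (∃ w t, e.Occurs (S.pos j) (.inv (.writer w) t)) ∨
      S.value (j + 1) = x ∧ ∃ w t, e.Occurs (S.pos j) (.inv (.writer w) t) := by
  obtain ⟨p, t, ho⟩ := S.isInv j hj
  have hl := congrArg Prod.snd (S.legal j hj p t ho)
  obtain rfl := ht _ _ _ ho
  rcases p with i | r | w
  · refine Or.inl ⟨hl.symm, ?_⟩
    rintro ⟨_, _, h⟩; cases ho.2.symm.trans h.2
  · refine Or.inl ⟨hl.symm, ?_⟩
    rintro ⟨_, _, h⟩; cases ho.2.symm.trans h.2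
  · exact Or.inr ⟨hl.symm, w, _, ho⟩

theorem Serialization.value_eq_of_le {e : A.Exec} (S : Serialization v₀ e)
    (ht : ∀ n p t, e.Occurs n (.inv p t) → t = txn x p) {i j : ℕ} (hij : i ≤ j)
    (hj : (j : ℕ∞) ≤ S.len) (hi : S.value i = x) : S.value j = x := by
  induction j, hij using Nat.le_induction with
  | base => exact hi
  | succ j _ ih =>
    have hlt : (j : ℕ∞) < S.len := lt_of_lt_of_le (by exact_mod_cast j.lt_succ_self) hj
    rcases S.value_succ ht hlt with h | h
    · rw [h.1]; exact ih hlt.le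
    · exact h.1

theorem Serialization.value_eq_or {e : A.Exec} (S : Serialization v₀ e)
    (ht : ∀ n p t, e.Occurs n (.inv p t) → t = txn x p) {j : ℕ} (hj : (j : ℕ∞) ≤ S.len) :
    S.value j = v₀ ∨ S.value j = x ∧ ∃ n w t, e.Occurs n (.inv (.writer w) t) := by
  induction j with
  | zero => exact Or.inl S.value_zero
  | succ j ih =>
    have hlt : (j : ℕ∞) < S.len := lt_of_lt_of_le (by exact_mod_cast j.lt_succ_self) hj
    rcases S.value_succ ht hlt with h | h
    · rw [h.1]; exact ih hlt.le
    · exact Or.inr ⟨h.1, _, h.2⟩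

/-- A READ whose answers have been sent by the servers returns the values in these answers, and is
serialized where the objects have these values. -/
theorem Extends.exists_value_eq (hS : SNOW v₀ A) {e : A.Exec} (hf : e.Fair)
    (S : Serialization v₀ e) {L₀ B L₁ r s}
    (he : Extends e (L₀ ++ .inv (.reader r) readAll :: (B ++ L₁)) s) {v}
    (hB : SendsAnswers B r v) :
    ∃ j : ℕ, (j : ℕ∞) < S.len ∧ S.pos j = L₀.length ∧ S.value j = v := by
  have hn : e.Occurs L₀.length (.inv (.reader r) readAll) := he.occurs _ _ (by simp)
  obtain ⟨c, ρ, hc⟩ := hS.W e hf he.wellFormed _ _ _ hn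
  obtain ⟨j, hj, hpos⟩ := S.complete _ _ _ _ _ hn hc
  have hn' := hn
  have hc' := hc
  rw [← hpos] at hn' hc'
  have hresp := (S.before_resp j hj _ _ _ _ hn' hc').2
  have hl := congrArg Prod.fst (S.legal j hj _ _ hn')
  have hρ : ρ = .values fun i => some (S.value j i) := by
    rw [← hresp, ← show (apply readAll (S.value j)).1 = S.resp j from hl]; simp [readAll, apply]
  subst hρ
  refine ⟨j, hj, hpos, funext fun i => ?_⟩
  obtain ⟨w, hw, a, b, c₁, c₂, d, d', h01, h02, h1, h2, h3, -, -, h4, h5, -, h6⟩ :=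
    hS.O.1 e hf he.wellFormed r _ _ _ _ _ hn hc i (Finset.mem_univ i)
  obtain ⟨dv, hv⟩ := hB.2 i
  obtain ⟨y, hy, hyv⟩ := List.mem_iff_getElem.1 hv
  have hX : e.Occurs (L₀.length + 1 + y) (.send (.server i) (.reader r) (.value i (v i) dv)) := by
    refine he.occurs _ _ ?_
    rw [List.getElem?_append_right (by omega), show L₀.length + 1 + y - L₀.length = y + 1 by omega,
      List.getElem?_cons_succ, List.getElem?_append_left hy, List.getElem?_eq_getElem hy, hyv]
  -- the answer that the reader receives arrives only after `B`
  have hlate : L₀.length + 1 + y ≤ c₂ := by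
    by_contra hlt
    have hm := he.getElem? h5 (by simp; omega)
    rw [List.getElem?_append_right (by omega),
      show c₂ - L₀.length = (c₂ - L₀.length - 1) + 1 by omega,
      List.getElem?_cons_succ, List.getElem?_append_left (by omega)] at hm
    exact hB.1 _ _ (List.mem_of_getElem? hm)
  have heq := (h6 (L₀.length + 1 + y) (by omega) (by omega) i (v i) dv).1 hX
  rw [heq] at hX
  have hact := hX.2.symm.trans h4.2
  simp only [Act.send.injEq, Msg.value.injEq, heq_eq_eq, true_and] at hact
  rw [hact.1]
  exact Option.some.inj hw

end TwoReaders

section TwoReaders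

variable {V : Fin 2 → Type u} {D H : Type u} {A : Algorithm 2 1 V D H}

open IOAutomaton

variable {v₀ x : ∀ i, V i}

/-! ### Readers that see only the initial values -/

/-- If reader `r` were to start its READ in the state `s`, without receiving anything else before,
then the servers, without receiving anything else before the request, could answer with the initial
values only. This depends only on the states of the reader and of the servers. -/
def SeesInitial (v₀ : ∀ i, V i) (A : Algorithm 2 1 V D H) (s : A.system.State) (r : Fin 2) : Prop :=
  ∀ L ρ' d, ReadStart A r (A.procState s (.reader r)) L ρ' d →
    ∀ i La σ' v, ServerAnswer A i r (A.procState s (.server i)) (d i) La σ' v → v = v₀ i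

/-- A READ that is performed in isolation in the state `s` sees either none or all of the WRITE, and
nothing of it if there is none. -/
theorem History.answers_eq_or (hS : SNOW v₀ A) {L₀} {s : A.system.State}
    (h : History x A L₀ s) {r} (hr : .reader r ∉ invokedClients L₀) {L ρ' d}
    (hs : ReadStart A r (A.procState s (.reader r)) L ρ' d) {La : Fin 2 → _} {σ' : ∀ _, _}
    {v : ∀ j, V j}
    (ha : ∀ j, ServerAnswer A j r (A.procState s (.server j)) (d j) (La j) (σ' j) (v j)) :
    v = v₀ ∨ v = x ∧ ∃ w, .writer w ∈ invokedClients L₀ := by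
  obtain ⟨B, s', h1, h2, h3, -⟩ := exists_run_sendsAnswers hs ha
  have h4 := h.append_readStart hr h1 h2
  obtain ⟨e, he, hf⟩ := h4.reaches.exists_fair
  obtain ⟨S⟩ := hS.S e hf he.wellFormed
  obtain ⟨j, hj, -, rfl⟩ := Extends.exists_value_eq (L₁ := []) hS hf S
    (by rwa [List.append_nil]) h3
  refine (S.value_eq_or (fun n p t => h4.txn_of_occurs he) hj.le).imp id fun h5 => ⟨h5.1, ?_⟩
  obtain ⟨n, w, t, ho⟩ := h5.2
  have := mem_invokedClients.2 ⟨t, he.mem ho (he.inv_lt _ _ _ ho)⟩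
  rw [invokedClients_append, invokedClients_inv_cons, h2] at this
  exact ⟨w, by simpa using this⟩

/-- If one server can only answer with the initial value, then so can the other one. -/
theorem History.answer_eq_of_forall (hS : SNOW v₀ A) (hx : ∀ i, x i ≠ v₀ i) {L₀}
    {s : A.system.State} (h : History x A L₀ s) {r} (hr : .reader r ∉ invokedClients L₀) {L ρ' d}
    (hs : ReadStart A r (A.procState s (.reader r)) L ρ' d) {j}
    (hj : ∀ La σ' v, ServerAnswer A j r (A.procState s (.server j)) (d j) La σ' v → v = v₀ j)
    {i La σ' v} (hi : ServerAnswer A i r (A.procState s (.server i)) (d i) La σ' v) :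
    v = v₀ i := by
  obtain ⟨La, σ', w, h1, rfl⟩ := exists_serverAnswers hS.N h hr hs hi
  rcases h.answers_eq_or hS hr hs h1 with rfl | ⟨rfl, -⟩
  · rfl
  · exact absurd (hj _ _ _ (h1 j)) (hx j)

theorem History.seesInitial_of_notMem (hS : SNOW v₀ A) {L₀}
    {s : A.system.State} (h : History x A L₀ s) {r} (hr : .reader r ∉ invokedClients L₀)
    (hw : ∀ w, .writer w ∉ invokedClients L₀) : SeesInitial v₀ A s r := by
  intro L ρ' d hs i La σ' v hi
  obtain ⟨La, σ', w, h1, rfl⟩ := exists_serverAnswers hS.N h hr hs hi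
  rcases h.answers_eq_or hS hr hs h1 with rfl | ⟨-, w, hw'⟩
  · rfl
  · exact absurd hw' (hw w)

/-- An action that does not take place at reader `r` does not make `r` see the WRITE: there is a
server at which it does not take place either, and which therefore still answers `r` with the
initial value. -/
theorem History.seesInitial_of_step (hS : SNOW v₀ A) (hx : ∀ i, x i ≠ v₀ i) {L₀}
    {s s' : A.system.State} {a} (h' : History x A L₀ s') {r} (hr : .reader r ∉ invokedClients L₀)
    (hstep : A.system.step s a s') (ha : a.loc ≠ .reader r) (hs : SeesInitial v₀ A s r) :
    SeesInitial v₀ A s' r := by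
  intro L ρ' d hstart i La σ' v hi
  obtain ⟨j, hj⟩ : ∃ j : Fin 2, a.loc ≠ .server j := by
    by_contra! hcon
    have := (hcon 0).symm.trans (hcon 1)
    simp at this
  refine h'.answer_eq_of_forall hS hx hr hstart (j := j) (fun La σ' v hv => ?_) hi
  rw [Algorithm.procState_eq_of_step hstep hj] at hv
  rw [Algorithm.procState_eq_of_step hstep ha] at hstart
  exact hs _ _ _ hstart _ _ _ _ hv

/-- A READ whose answers have been sent can be completed: the answers are delivered and the reader
runs alone. The states of the other processes are not affected. -/
theorem exists_run_complete (hS : SNOW v₀ A) {L₀} {s : A.system.State} (h : History x A L₀ s) {r}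
    (hr : .reader r ∉ invokedClients L₀) {L ρ' d}
    (hs : ReadStart A r (A.procState s (.reader r)) L ρ' d) {La : Fin 2 → _} {σ' : ∀ _, _}
    {v : ∀ j, V j}
    (ha : ∀ j, ServerAnswer A j r (A.procState s (.server j)) (d j) (La j) (σ' j) (v j)) :
    ∃ B B' s', A.system.Run s (.inv (.reader r) readAll :: (B ++ B')) s' ∧
      invokedClients (B ++ B') = [] ∧ SendsAnswers B r v ∧
      (∃ ρ, Act.resp (.reader r) ρ ∈ B ++ B') ∧
      (∀ i, A.procState s' (.server i) = σ' i) ∧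
      ∀ r', r' ≠ r → A.procState s' (.reader r') = A.procState s (.reader r') := by
  obtain ⟨B, s₁, h1, h2, h3, h4, h5, h6⟩ := exists_run_sendsAnswers hs ha
  choose dv h6 using h6
  have hin : ∀ i, (.recv (.server i) (.reader r) (.value i (v i) (dv i)) : Act 2 1 V D H) ∈
      procInp (.reader r) := fun i => Or.inr ⟨.server i, _, by simp, rfl⟩
  obtain ⟨t, ht⟩ := A.exists_input_step (hin 0) (A.procState s₁ (.reader r))
  obtain ⟨s₂, h7, -⟩ := Algorithm.exists_step ht (fun _ _ he => by cases he; exact h6 0)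
  obtain ⟨t', ht'⟩ := A.exists_input_step (hin 1) (A.procState s₂ (.reader r))
  obtain ⟨s₃, h8, -⟩ := Algorithm.exists_step ht' (fun _ _ he => by
    cases he; exact Algorithm.inTransit_of_step h7 (by simp) (h6 1))
  have h9 := h1.append (.cons h7 (.singleton h8))
  rw [List.cons_append] at h9
  set R : List (Act 2 1 V D H) := [.recv (.server 0) (.reader r) (.value 0 (v 0) (dv 0)),
    .recv (.server 1) (.reader r) (.value 1 (v 1) (dv 1))] with hRdef
  have hRnil : invokedClients (B ++ R) = [] := by rw [invokedClients_append, h2]; rfl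
  have h10 := h.append_readStart hr h9 hRnil
  obtain ⟨e, he, hf, hloc⟩ := h10.reaches.exists_fairFor (.reader r)
  have hlen : (L₀ ++ Act.inv (.reader r) readAll :: (B ++ R)).length =
      L₀.length + 1 + B.length + 2 := by simp [hRdef]; omega
  have hn : e.Occurs L₀.length (.inv (.reader r) readAll) := he.occurs _ _ (by simp)
  have hrecv : ∀ i ∈ (Finset.univ : Finset (Fin 2)), ∃ c v d, L₀.length < c ∧
      c ≤ L₀.length + 1 + B.length + 1 ∧
      e.Occurs c (.recv (.server i) (.reader r) (.value i v d)) := by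
    intro i _
    refine ⟨L₀.length + 1 + B.length + i.1, v i, dv i, by omega, by omega, he.occurs _ _ ?_⟩
    rw [List.getElem?_append_right (by omega),
      show L₀.length + 1 + B.length + i.1 - L₀.length = (B.length + i.1) + 1 by omega,
      List.getElem?_cons_succ, List.getElem?_append_right (by omega), Nat.add_sub_cancel_left]
    fin_cases i <;> rfl
  obtain ⟨c, ρ, hc, hco⟩ := hS.O.2 e he.wellFormed r hf _ _ _ _ hn hrecv
    fun j a hj ho => (hloc j a ho (by omega)).notMem_procInp
  obtain ⟨L', t, h11, h12, h13⟩ := he.exists_local_run hloc (c + 1)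
  obtain ⟨s₄, h14, -⟩ := Algorithm.exists_run h11 h12 rfl
  have hrun := h9.append h14
  rw [List.cons_append, List.append_assoc] at hrun
  have hframe : ∀ q, q ≠ .reader r → A.procState s₄ q = A.procState s₁ q := by
    intro q hq
    refine Algorithm.procState_eq_of_run (.cons h7 (.cons h8 h14)) fun a ha => ?_
    simp only [List.mem_cons] at ha
    rcases ha with rfl | rfl | ha
    · exact hq.symm
    · exact hq.symm
    · rw [(h12 a ha).loc_eq]; exact hq.symm
  refine ⟨B, R ++ L', s₄, hrun, ?_, h3, ⟨ρ, ?_⟩, ?_, ?_⟩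
  · rw [← List.append_assoc, invokedClients_append, hRnil, invokedClients_of_isLocal h12]; rfl
  · by_cases hcl : c < (L₀ ++ Act.inv (.reader r) readAll :: (B ++ R)).length
    · have hm := he.getElem? hco hcl
      rw [List.getElem?_append_right (by omega),
        show c - L₀.length = (c - L₀.length - 1) + 1 by omega, List.getElem?_cons_succ] at hm
      rw [← List.append_assoc]
      exact List.mem_append_left _ (List.mem_of_getElem? hm)
    · rw [← List.append_assoc]
      exact List.mem_append_right _ (h13 c _ (not_lt.1 hcl) (by omega) hco)
  · intro i; rw [hframe _ (by simp), h4]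
  · intro r' hr'; rw [hframe _ (by simpa using hr'), h5 r' hr']

/-- A READ sees the WRITE if it is invoked after a transaction that has completed, which is either
the WRITE or a READ that sees the WRITE. -/
theorem History.answers_eq_of_resp (hS : SNOW v₀ A) {L₁ L₂ L₃ L₄ : List (Act 2 1 V D H)}
    {s : A.system.State} {p r}
    (h : History x A (L₁ ++ .inv p (txn x p) :: L₂) s)
    (hr : .reader r ∉ invokedClients (L₁ ++ .inv p (txn x p) :: L₂))
    (hresp : ∃ ρ, Act.resp p ρ ∈ L₂)
    (hp : (∃ w, p = .writer w) ∨ ∃ r', p = .reader r' ∧ L₂ = L₃ ++ L₄ ∧ SendsAnswers L₃ r' x)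
    {L ρ' d} (hs : ReadStart A r (A.procState s (.reader r)) L ρ' d) {La : Fin 2 → _}
    {σ' : ∀ _, _} {v : ∀ j, V j}
    (ha : ∀ j, ServerAnswer A j r (A.procState s (.server j)) (d j) (La j) (σ' j) (v j)) :
    v = x := by
  obtain ⟨B, s', h1, h2, h3, -⟩ := exists_run_sendsAnswers hs ha
  have h4 := h.append_readStart hr h1 h2
  obtain ⟨e, he, hf⟩ := h4.reaches.exists_fair
  have ht : ∀ n p t, e.Occurs n (.inv p t) → t = txn x p := fun n p t => h4.txn_of_occurs he
  obtain ⟨S⟩ := hS.S e hf he.wellFormed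
  obtain ⟨j, hj, hpos, rfl⟩ := Extends.exists_value_eq (L₁ := []) hS hf S
    (by rwa [List.append_nil]) h3
  obtain ⟨ρ, hρ⟩ := hresp
  obtain ⟨y, hy, hyv⟩ := List.mem_iff_getElem.1 hρ
  have hn : e.Occurs L₁.length (.inv p (txn x p)) := he.occurs _ _ (by simp)
  have hc : e.Occurs (L₁.length + 1 + y) (.resp p ρ) := by
    refine he.occurs _ _ ?_
    rw [List.append_assoc, List.getElem?_append_right (by omega), List.cons_append,
      show L₁.length + 1 + y - L₁.length = y + 1 by omega, List.getElem?_cons_succ,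
      List.getElem?_append_left hy, List.getElem?_eq_getElem hy, hyv]
  obtain ⟨j', hlt, hpos'⟩ := S.exists_lt hS.W hf he.wellFormed hn hc (by omega) hj
    (by rw [hpos]; simp; omega)
  have hj' : (j' : ℕ∞) < S.len := lt_trans (by exact_mod_cast hlt) hj
  rcases hp with ⟨w, rfl⟩ | ⟨r', rfl, rfl, hB⟩
  · rcases S.value_succ ht hj' with h5 | h5
    · exact absurd ⟨w, _, by rw [hpos']; exact hn⟩ h5.2
    · exact S.value_eq_of_le ht hlt hj.le h5.1
  · obtain ⟨j₁, hj₁, hpos₁, hv⟩ := Extends.exists_value_eq (L₀ := L₁) (B := L₃)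
      (L₁ := L₄ ++ Act.inv (.reader r) readAll :: B) hS hf S
      (by simpa [txn] using he) hB
    obtain rfl := S.distinct _ _ hj₁ hj' (hpos₁.trans hpos'.symm)
    exact S.value_eq_of_le ht hlt.le hj.le hv

/-- If one reader sees only the initial values, then so does the other one, `r`. Otherwise `r`
could complete a READ that sees the WRITE, and a READ of `r'` could follow and would see it, too.
But server `0` would give the same answer to `r'` if only server `0`, and not server `1`, had
received the request of `r` before. In that case server `1` can answer `r'` with the initial value
only, hence so can server `0`. -/
theorem History.seesInitial_of_seesInitial (hS : SNOW v₀ A) (hR : ReadersDoNotWait A)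
    (hx : ∀ i, x i ≠ v₀ i) {L₀} {s : A.system.State} (h : History x A L₀ s) {r r'} (hne : r' ≠ r)
    (hr : .reader r ∉ invokedClients L₀) (hr' : .reader r' ∉ invokedClients L₀)
    (hs : SeesInitial v₀ A s r') : SeesInitial v₀ A s r := by
  intro L ρ' d hstart i₀ La₀ σ₀ v₁ hi₀
  by_contra hv₁
  obtain ⟨La, σ', v, ha, rfl⟩ := exists_serverAnswers hS.N h hr hstart hi₀
  obtain rfl : v = x := by
    rcases h.answers_eq_or hS hr hstart ha with rfl | h1
    · exact absurd rfl hv₁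
    · exact h1.1
  obtain ⟨B, B', s₁, h1, h2, h3, h4, h5, h6⟩ := exists_run_complete hS h hr hstart ha
  have hnot : .reader r' ∉ invokedClients (L₀ ++ Act.inv (.reader r) readAll :: (B ++ B')) := by
    rw [invokedClients_append, invokedClients_inv_cons, h2]
    simpa [hne] using hr'
  have h7 := h.append_readStart hr h1 h2
  obtain ⟨L', ρ₁, d', hstart'⟩ := exists_readStart hR h7 hnot
  choose Lb τ u hb using exists_serverAnswer hS.N h7 hnot hstart'
  have hu : u = v := h7.answers_eq_of_resp hS hnot h4 (Or.inr ⟨r, rfl, rfl, h3⟩) hstart' hb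
  rw [h6 r' hne] at hstart'
  -- reader `r` has contacted the servers, but only server `0` has received its request
  obtain ⟨s₂, k1, k2, k3⟩ := hstart.exists_run
  have ha0 := ha 0
  rw [← k2 _ (by simp)] at ha0
  obtain ⟨s₃, k4, k5, k6, -⟩ := ha0.exists_run (k3 0)
  have k7 := k1.append k4
  rw [List.cons_append] at k7
  have hnil : invokedClients
      (L ++ Act.recv (.reader r) (.server 0) (.readReq (d 0)) :: La 0) = [] := by
    rw [invokedClients_append, invokedClients_recv_cons, invokedClients_of_isLocal hstart.isLocal,
      invokedClients_of_isLocal (ha 0).isLocal]; rfl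
  have k8 := h.append_readStart hr k7 hnil
  have hnot' : .reader r' ∉ invokedClients (L₀ ++ Act.inv (.reader r) readAll ::
      (L ++ Act.recv (.reader r) (.server 0) (.readReq (d 0)) :: La 0)) := by
    rw [invokedClients_append, invokedClients_inv_cons, hnil]
    simpa [hne] using hr'
  have hst3 : ReadStart A r' (A.procState s₃ (.reader r')) L' ρ₁ d' := by
    rwa [k6 _ (by simp), k2 _ (by simpa using hne)]
  have hb0 : ServerAnswer A 0 r' (A.procState s₃ (.server 0)) (d' 0) (Lb 0) (τ 0) (u 0) := by
    rw [k5, ← h5]; exact hb 0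
  have := k8.answer_eq_of_forall hS hx hnot' hst3 (j := 1) (fun Lc τ' w hw => by
    rw [k6 _ (by simp), k2 _ (by simp)] at hw
    exact hs _ _ _ hstart' _ _ _ _ hw) hb0
  rw [hu] at this
  exact hx 0 this

/-! ### The execution of the WRITE -/

/-- Along a fair execution in which only the WRITE is invoked, both readers always see only the
initial values. After the response of the WRITE this contradicts strict serializability. -/
theorem not_snow_and_readersDoNotWait (hx : ∀ i, x i ≠ v₀ i) (hS : SNOW v₀ A)
    (hR : ReadersDoNotWait A) : False := by
  obtain ⟨s₀, h0⟩ := A.system.start_nonempty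
  have hin : (.inv (.writer 0) (writeAll x) : Act 2 1 V D H) ∈ procInp (.writer 0) :=
    Or.inl ⟨writeAll x, trivial, rfl⟩
  obtain ⟨t, ht⟩ := A.exists_input_step hin (A.procState s₀ (.writer 0))
  obtain ⟨s₁, h1, -⟩ := Algorithm.exists_step ht (fun _ _ he => by cases he)
  have hnil : History x A [] s₀ := ⟨⟨⟨s₀, h0, .nil _⟩, by simp⟩, by simp⟩
  have hinv : History x A [.inv (.writer 0) (writeAll x)] s₁ :=
    hnil.append_inv (p := .writer 0) (by simp) (.singleton h1) rfl
  obtain ⟨e, he, hf⟩ := hinv.reaches.exists_fair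
  have hn : e.Occurs 0 (.inv (.writer 0) (writeAll x)) := he.occurs _ _ rfl
  have hist : ∀ n : ℕ, (n : ℕ∞) ≤ e.len → History x A (prefixActs e n) (e.state n) := fun n hlen =>
    ⟨he.reaches_prefix hlen, fun p t hm => by
      obtain ⟨i, -, ho⟩ := (mem_prefixActs hlen).1 hm
      exact hinv.txn_of_occurs he ho⟩
  have hreader : ∀ n : ℕ, (n : ℕ∞) ≤ e.len → ∀ r, .reader r ∉ invokedClients (prefixActs e n) := by
    intro n hlen r hm
    obtain ⟨t, hm⟩ := mem_invokedClients.1 hm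
    obtain ⟨i, -, ho⟩ := (mem_prefixActs hlen).1 hm
    have := he.mem ho (he.inv_lt _ _ _ ho)
    simp at this
  have hsees : ∀ n : ℕ, (n : ℕ∞) ≤ e.len → ∀ r, SeesInitial v₀ A (e.state n) r := by
    intro n
    induction n with
    | zero =>
      intro hlen r
      exact (hist 0 hlen).seesInitial_of_notMem hS (hreader 0 hlen r) (by simp [prefixActs])
    | succ n ih =>
      intro hlen r
      have hlt : (n : ℕ∞) < e.len := lt_of_lt_of_le (by exact_mod_cast n.lt_succ_self) hlen
      have key : ∀ r, (e.act n).loc ≠ .reader r → SeesInitial v₀ A (e.state (n + 1)) r :=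
        fun r hr => (hist _ hlen).seesInitial_of_step hS hx (hreader _ hlen r) (e.steps n hlt) hr
          (ih hlt.le r)
      by_cases hr : (e.act n).loc = .reader r
      · obtain ⟨r', hr'⟩ := exists_ne r
        exact (hist _ hlen).seesInitial_of_seesInitial hS hR hx hr' (hreader _ hlen r)
          (hreader _ hlen r') (key r' (by rw [hr]; simpa using hr'.symm))
      · exact key r hr
  obtain ⟨c, ρ, hc0, hc, -⟩ := hS.W e hf he.wellFormed _ _ _ hn
  have hlen : ((c + 1 : ℕ) : ℕ∞) ≤ e.len := by
    push_cast; exact Order.add_one_le_of_lt hc.1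
  have hfin := hist _ hlen
  obtain ⟨L, ρ', d, hstart⟩ := exists_readStart hR hfin (hreader _ hlen 0)
  choose La σ' v ha using exists_serverAnswer hS.N hfin (hreader _ hlen 0) hstart
  have hlist : prefixActs e (c + 1) =
      [] ++ Act.inv (.writer 0) (txn x (.writer 0)) :: (List.range' 1 c).map e.act := by
    rw [prefixActs, List.range'_succ, List.map_cons, hn.2]; rfl
  have hnr := hreader _ hlen 0
  rw [hlist] at hfin hnr
  have hv := hfin.answers_eq_of_resp (L₃ := []) (L₄ := []) hS hnr ⟨ρ, List.mem_map.2 ⟨c, by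
    rw [List.mem_range'_1]; omega, hc.2⟩⟩ (Or.inl ⟨0, rfl⟩) hstart ha
  have := hsees _ hlen 0 _ _ _ hstart 0 _ _ _ (ha 0)
  rw [hv] at this
  exact hx 0 this

end TwoReaders
end Snow

theorem mainTheorem2 {V : Fin 2 → Type u} [∀ i, Nontrivial (V i)] (v₀ : ∀ i, V i)
    {D H : Type u} (A : Snow.Algorithm 2 1 V D H) :
    ¬ (Snow.SNOW v₀ A ∧ Snow.ReadersDoNotWait A) := by
  choose x hx using fun i => exists_ne (v₀ i)
  exact fun h => Snow.not_snow_and_readersDoNotWait hx h.1 h.2
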